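/- **Setting.** There are $n\ge 1$ players, each with the actions $\{1,\dots,k\}$, $k\ge 1$, a finite non-empty set $\mathcal T$ of types, and utilities $u_i(\theta,\mathbf a)\in[0,1]$ of player $i$ with type $\theta$ at the action profile $\mathbf a$. The game is *$\lambda$-large*: for $i\ne i'$, a change of $a_i$ changes $u_{i'}(\theta,\mathbf a)$ by at most $\lambda$. A distribution $D$ on action profiles is an *$\alpha$-approximate correlated equilibrium* (CE) for the types $\tau=(\tau_1,\dots,\tau_n)$ if $\mathbb E_{\mathbf a\sim D}[u_i(\tau_i,\mathbf a)]\ge \mathbb E_{\mathbf a\sim D}[u_i(\tau_i,(f(a_i),\mathbf a_{-i}))]-\alpha$ for all $i$ and all $f:\{1,\dots,k\}\to\{1,\dots,k\}$. Let $\varepsilon,\delta,\lambda,\beta\in(0,1]$, $T\ge 1$, and let $R=nk|\mathcal T|T$. A *no-swap-regret algorithm* $\mathcal A_{\mathsf{swap}}$ is an online algorithm that starts with the uniform distribution, chooses in each period a distribution $\pi_t$ on the $k$ actions as a (measurable) function of the previous loss vectors $l_1,\dots,l_{t-1}$, and satisfies, for all losses in $[0,1]$ and all $f$, $\frac1T\sum_{t=1}^T\sum_j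 \pi_t^j\,(l_t^j-l_t^{f(j)})\le k\sqrt{2\log k/T}$. A *Median Mechanism* $\mathcal M$ is a randomized mechanism that holds $\tau\in\mathcal T^n$ and answers $R$ adaptively chosen $\lambda$-sensitive queries $Q_r:\mathcal T^n\to\mathbb R$ (changing one type changes $Q_r$ by at most $\lambda$) such that, for every (measurable) adaptive querier, the transcript is $(\varepsilon,\delta)$-differentially private and, with probability at least $1-\beta$, all answers $a_r$ satisfy $$|a_r-Q_r(\tau)|\le 16\,\varepsilon^{-1}\lambda\sqrt{n\log|\mathcal T|}\,\log(2R/\beta)\,\log(4/\delta).$$ NRMEDIAN runs in periods $t=1,\dots,T$. In period $t$ it asks one and the same $\mathcal M$, for every player $i$, action $j$ and type $\theta$, for the loss $l=1-\mathbb E_{\pi_{-i,t}}[u_i(\theta,(j,a_{-i}))]$, rescaled to $(l+1)/3\in[\frac13,\frac23]$, where $\pi_{i',t}$ is the distribution that $\mathcal A_{\mathsf{swap}}$ chooses for player $i'\neq i$, of type $\tau_{i'}$, from the earlier answers for the player $i'$ and the type $\tau_{i'}$. It returns to each player $i$ the distributions $\pi_{i,1},\dots,\pi_{i,T}$ that $\mathcal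 A_{\mathsf{swap}}$ chooses from the answers for the player $i$ and her type $\tau_i$. These outputs define the following distribution on action profiles: draw $t\in\{1,\dots,T\}$ uniformly, then draw $a_i\sim\pi_{i,t}$ independently. **Theorem (Computing CE, many actions).** A no-swap-regret algorithm and a Median Mechanism exist for all parameters as above. Moreover there is a universal constant $C>0$ such that the following holds. If $$16\,\varepsilon^{-1}\lambda\sqrt{n\log|\mathcal T|}\,\log(2|\mathcal T|nkT/\beta)\,\log(4/\delta)\le\tfrac16 \qquad\text{and}\qquad T\ge \frac{k^2}{\lambda^2 n},$$ then for every no-swap-regret algorithm, every Median Mechanism, every $\lambda$-large game with utilities in $[0,1]$ and every $\tau\in\mathcal T^n$, with probability at least $1-\beta$ the distribution returned by NRMEDIAN is an $\alpha$-approximate correlated equilibrium for $\tau$, where $$\alpha = C\cdot\frac{\lambda\sqrt n\,(1+\log|\mathcal T|)^{3/2}\,(1+\log(k/\beta))\,(1+\log(1/\delta))}{\varepsilon}\cdot\Bigl(1+\log\frac{nT}{k^2}\Bigr).$$ In particular, for $T=\lceil k^2/(\lambda^2 n)\rceil$ the last factor is $O(1+\log(n/\lambda))$, so that $\alpha=\tilde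 O\bigl(\lambda\sqrt n\,\log^{3/2}|\mathcal T|\,\log(k/\beta)\,\log(1/\delta)/\varepsilon\bigr)$: the dependence on the number of actions is only logarithmic. -/

import Mathlib

open MeasureTheory

noncomputable section

namespace LargeGame

/-! ### Games with `n` players, `k` actions each, and type set `𝒯`

`u i θ a` is the utility of player `i` when her type is `θ` and the action profile is `a`. -/

/-- Changing the action of one player changes the utility of any *other* player by at most
`lam`, whatever the type of that other player. -/
def IsLarge {𝒯 : Type*} {n k : ℕ} (u : Fin n → 𝒯 → (Fin n → Fin k) → ℝ) (lam : ℝ) : Prop :=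
  ∀ i i' : Fin n, i ≠ i' → ∀ (θ : 𝒯) (a : Fin n → Fin k) (b : Fin k),
    |u i' θ a - u i' θ (Function.update a i b)| ≤ lam

/-- The expectation of `v` when the actions are drawn independently, player `i` using the
mixed strategy `p i`. -/
def expect {n k : ℕ} (p : Fin n → Fin k → ℝ) (v : (Fin n → Fin k) → ℝ) : ℝ :=
  ∑ a : Fin n → Fin k, (∏ i, p i (a i)) * v a

/-- `D` is an `η`-approximate correlated equilibrium of the complete-information game with
utilities `v i`: it is a probability distribution on action profiles, and no player `i` gains
more than `η` in expectation by applying some `f` to her recommended action. -/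
def IsApproxCE {n k : ℕ} (η : ℝ) (v : Fin n → (Fin n → Fin k) → ℝ)
    (D : (Fin n → Fin k) → ℝ) : Prop :=
  D ∈ stdSimplex ℝ (Fin n → Fin k) ∧
  ∀ (i : Fin n) (f : Fin k → Fin k),
    ∑ a, D a * v i (Function.update a i (f (a i))) - η ≤ ∑ a, D a * v i a

/-- The correlated distribution of a collection of sequences of mixed strategies: draw a period
`t` uniformly among the `T` periods, then let the players draw their actions independently,
player `i` from `π i t`. -/
def averagePlay {n k : ℕ} (T : ℕ) (π : Fin n → ℕ → Fin k → ℝ) : (Fin n → Fin k) → ℝ :=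
  fun a => (∑ t ∈ Finset.range T, ∏ i, π i t (a i)) / T

/-! ### Online learning -/

/-- A deterministic online learning algorithm on `k` actions. `play t l` is the mixed strategy
used in period `t` (periods are numbered from `0`) after the loss vectors `l 0, …, l (t-1)` have
been observed. It starts from the uniform distribution. -/
structure OnlineAlgorithm (k : ℕ) where
  play : (t : ℕ) → (Fin t → Fin k → ℝ) → Fin k → ℝ
  play_mem : ∀ t l, play t l ∈ stdSimplex ℝ (Fin k)
  play_zero : ∀ l j, play 0 l j = 1 / k
  measurable_play : ∀ t, Measurable (play t)

/-- The average regret over `T` periods, on the losses `L`, for not having replaced each action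
`j` by `f j`. -/
def OnlineAlgorithm.regret {k : ℕ} (A : OnlineAlgorithm k) (T : ℕ) (L : ℕ → Fin k → ℝ)
    (f : Fin k → Fin k) : ℝ :=
  (∑ t ∈ Finset.range T,
    (∑ j, A.play t (fun s => L s) j * L t j - ∑ j, A.play t (fun s => L s) j * L t (f j))) / T

/-- The guarantee of the no-swap-regret algorithm for the horizon `T`. Since the algorithm is
deterministic, quantifying over all loss sequences covers losses that adapt to its play. -/
def OnlineAlgorithm.IsNoSwapRegret {k : ℕ} (A : OnlineAlgorithm k) (T : ℕ) : Prop :=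
  ∀ L : ℕ → Fin k → ℝ, (∀ t j, L t j ∈ Set.Icc (0 : ℝ) 1) →
    ∀ f : Fin k → Fin k, A.regret T L f ≤ k * √(2 * Real.log k / T)

/-! ### Interactive mechanisms that answer adaptive queries -/

/-- A query maps the tuple of types to a real number. -/
abbrev Query (𝒯 : Type*) (n : ℕ) : Type _ := (Fin n → 𝒯) → ℝ

/-- Changing the type of one player changes the value of the query by at most `lam`. -/
def Query.IsSensitive {𝒯 : Type*} {n : ℕ} (Q : Query 𝒯 n) (lam : ℝ) : Prop :=
  ∀ (τ : Fin n → 𝒯) (i : Fin n) (θ : 𝒯), |Q τ - Q (Function.update τ i θ)| ≤ lam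

/-- An adaptive querier: `B r a` is the query of round `r` (rounds are numbered from `0`) when
the previous answers were `a 0, …, a (r-1)`; these determine the previous queries. -/
abbrev Querier (𝒯 : Type*) (n : ℕ) : Type _ := (r : ℕ) → (Fin r → ℝ) → Query 𝒯 n

/-- The queriers of the experiment: measurable, and asking only `lam`-sensitive queries. -/
def Querier.IsAdmissible {𝒯 : Type*} {n : ℕ} (B : Querier 𝒯 n) (lam : ℝ) : Prop :=
  (∀ r, Measurable (B r)) ∧ ∀ r a, (B r a).IsSensitive lam

/-- A randomized interactive mechanism. `ω : Ω` is the outcome of all its internal coin tosses,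
distributed according to `μ`, and `answer r ω τ q` is its answer in round `r` when it holds the
tuple of types `τ` and `q 0, …, q r` are the queries asked up to this round. -/
structure QueryMechanism (𝒯 : Type*) (n : ℕ) where
  Ω : Type
  [mΩ : MeasurableSpace Ω]
  μ : Measure Ω
  [prob : IsProbabilityMeasure μ]
  answer : (r : ℕ) → Ω → (Fin n → 𝒯) → (Fin (r + 1) → Query 𝒯 n) → ℝ
  measurable_answer : ∀ r τ,
    Measurable fun p : Ω × (Fin (r + 1) → Query 𝒯 n) => answer r p.1 τ p.2

attribute [instance] QueryMechanism.mΩ QueryMechanism.prob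

/-- The answers of the first `r` rounds of the interaction between the mechanism and `B`. -/
def QueryMechanism.answers {𝒯 : Type*} {n : ℕ} (M : QueryMechanism 𝒯 n) (B : Querier 𝒯 n)
    (τ : Fin n → 𝒯) (ω : M.Ω) : (r : ℕ) → Fin r → ℝ
  | 0 => Fin.elim0
  | r + 1 =>
    Fin.snoc (α := fun _ => ℝ) (M.answers B τ ω r)
      (M.answer r ω τ fun s =>
        B s fun m => M.answers B τ ω r ⟨m, lt_of_lt_of_le m.isLt (Nat.lt_succ_iff.mp s.isLt)⟩)

/-- The transcript of `R` rounds is `(ε, δ)`-differentially private against every adaptive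
querier that asks `lam`-sensitive queries. (The queries in the transcript are measurable functions
of the answers, so events are stated in terms of the answers.) -/
def QueryMechanism.IsPrivate {𝒯 : Type*} {n : ℕ} (M : QueryMechanism 𝒯 n)
    (ε δ lam : ℝ) (R : ℕ) : Prop :=
  ∀ B : Querier 𝒯 n, B.IsAdmissible lam →
    ∀ (τ : Fin n → 𝒯) (i : Fin n) (θ : 𝒯) (E : Set (Fin R → ℝ)), MeasurableSet E →
      M.μ {ω | M.answers B τ ω R ∈ E} ≤
        ENNReal.ofReal (Real.exp ε) * M.μ {ω | M.answers B (Function.update τ i θ) ω R ∈ E}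
          + ENNReal.ofReal δ

/-- Against every adaptive querier that asks `lam`-sensitive queries, all `R` answers are within
`α` of the true values of the queries, except with probability at most `β`. -/
def QueryMechanism.IsAccurate {𝒯 : Type*} {n : ℕ} (M : QueryMechanism 𝒯 n)
    (α β lam : ℝ) (R : ℕ) : Prop :=
  ∀ B : Querier 𝒯 n, B.IsAdmissible lam → ∀ τ : Fin n → 𝒯,
    M.μ {ω | ∃ r : Fin R, α <
        |M.answers B τ ω R r - B r (fun m => M.answers B τ ω R ⟨m, m.isLt.trans r.isLt⟩) τ|}
      ≤ ENNReal.ofReal β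

/-- The error bound `16 ε⁻¹ λ √(n log |𝒯|) log (2R/β) log (4/δ)` of the Median Mechanism, where
`m = |𝒯|`. -/
def medianError (n m R : ℕ) (ε δ lam β : ℝ) : ℝ :=
  16 * ε⁻¹ * lam * √(n * Real.log m) * Real.log (2 * R / β) * Real.log (4 / δ)

/-- The privacy and accuracy guarantees of the Median Mechanism. -/
def QueryMechanism.IsMedianMechanism {𝒯 : Type*} [Fintype 𝒯] {n : ℕ} (M : QueryMechanism 𝒯 n)
    (ε δ lam β : ℝ) (R : ℕ) : Prop :=
  M.IsPrivate ε δ lam R ∧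
  M.IsAccurate (medianError n (Fintype.card 𝒯) R ε δ lam β) β lam R

/-! ### NRMEDIAN

In every period `t` the inner mechanism asks one query for each triple `(i, j, θ)` of a player, an
action and a type, in the order given by the enumeration `e`. -/

section NRMedian

variable {𝒯 : Type*} [Fintype 𝒯] {n k : ℕ}

/-- Player `i`'s mixed strategy in period `t` if her type is `θ` and the (noisy) losses of
player `i'` of type `θ'` for action `j` in period `s` are `Lam s i' j θ'`. -/
def strategy (A : OnlineAlgorithm k) (Lam : ℕ → Fin n → Fin k → 𝒯 → ℝ) (i : Fin n) (θ : 𝒯)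
    (t : ℕ) : Fin k → ℝ :=
  A.play t fun s j => Lam s i j θ

/-- The query of period `t` for `(i, j, θ)`: the loss `1 - 𝔼[u i θ (j, a₋ᵢ)]`, mapped affinely
from `[0, 1]` to `[1/3, 2/3]` by `l ↦ (l + 1) / 3`, where the other players `i'`, of types `τ i'`,
play according to their strategies of period `t` given the previous losses `Lam`. -/
def lossQuery (A : OnlineAlgorithm k) (u : Fin n → 𝒯 → (Fin n → Fin k) → ℝ)
    (Lam : ℕ → Fin n → Fin k → 𝒯 → ℝ) (t : ℕ) (i : Fin n) (j : Fin k) (θ : 𝒯) : Query 𝒯 n :=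
  fun τ =>
    let p : Fin n → Fin k → ℝ :=
      Function.update (fun i' => strategy A Lam i' (τ i') t) i (Pi.single j 1)
    ((1 - expect p (u i θ)) + 1) / 3

/-- The losses encoded by a list of answers: the answer to the query of period `t` for
`(i, j, θ)` is the one of round `t * N + e (i, j, θ)`, `N` being the number of queries per
period. Entries that have not been answered yet are set to `0`; they are never used. -/
def decode (e : Fin n × Fin k × 𝒯 ≃ Fin (n * k * Fintype.card 𝒯)) {r : ℕ} (a : Fin r → ℝ) :
    ℕ → Fin n → Fin k → 𝒯 → ℝ :=
  fun t i j θ =>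
    if h : t * (n * k * Fintype.card 𝒯) + e (i, j, θ) < r then a ⟨_, h⟩ else 0

/-- The adaptive querier run by the inner mechanism: round `r` belongs to period `r / N` and asks
the query number `r % N` of this period. -/
def nrQuerier (A : OnlineAlgorithm k) (u : Fin n → 𝒯 → (Fin n → Fin k) → ℝ)
    (e : Fin n × Fin k × 𝒯 ≃ Fin (n * k * Fintype.card 𝒯)) : Querier 𝒯 n :=
  fun r a =>
    if h : 0 < n * k * Fintype.card 𝒯 then
      let x := e.symm ⟨r % (n * k * Fintype.card 𝒯), Nat.mod_lt r h⟩
      lossQuery A u (decode e a) (r / (n * k * Fintype.card 𝒯)) x.1 x.2.1 x.2.2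
    else 0

/-- The inner mechanism: the noisy losses of `T` periods, obtained from the answers of the single
query mechanism `M` to all queries. -/
def nrMedianShared (A : OnlineAlgorithm k) (M : QueryMechanism 𝒯 n)
    (u : Fin n → 𝒯 → (Fin n → Fin k) → ℝ)
    (e : Fin n × Fin k × 𝒯 ≃ Fin (n * k * Fintype.card 𝒯)) (T : ℕ) (τ : Fin n → 𝒯) (ω : M.Ω) :
    ℕ → Fin n → Fin k → 𝒯 → ℝ :=
  decode e (M.answers (nrQuerier A u e) τ ω (T * (n * k * Fintype.card 𝒯)))

/-- The outer mechanism: the mixed strategies of player `i` in the periods `t = 0, …, T - 1`,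
computed from the shared noisy losses and her own type. -/
def nrMedian (A : OnlineAlgorithm k) (M : QueryMechanism 𝒯 n)
    (u : Fin n → 𝒯 → (Fin n → Fin k) → ℝ)
    (e : Fin n × Fin k × 𝒯 ≃ Fin (n * k * Fintype.card 𝒯)) (T : ℕ) (τ : Fin n → 𝒯) (ω : M.Ω) :
    Fin n → ℕ → Fin k → ℝ :=
  fun i t => strategy A (nrMedianShared A M u e T τ ω) i (τ i) t

end NRMedian

end LargeGame

end

/-! ### The exponential distribution -/

namespace LargeGame

/-! Once all answers of the query mechanism are accurate, the equilibrium claim is deterministic.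
The error is at most 1/6, so the noisy losses stay in `[0, 1]` and the swap regret bound, valid for
every loss sequence, applies to them. The rescaling by 3 and the two losses compared in the regret
turn it into a gain of at most `3 * (regret + 2 * err)` (`isApproxCE_nrMedian`), and
`approximation_bound` estimates this number. The queries are admissible because, given the earlier
answers, the type of a player matters only through her own mixed strategy, whose influence on the
others is bounded by largeness (`lossQuery_isSensitive`).

The Median Mechanism keeps the set of type tuples that are still possible and answers with the
median of the query on this set. A noisy test compares the median with the truth. If they look far
apart, the wrong half is discarded and the query is tested again. With moderate noise the true tuple
survives, so at most `c = log₂ |𝒯|ⁿ` updates occur (`replay_history_invariant`). Everything released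
is a function of the list of test outcomes, so only this list has to be private. Between two updates
the threshold noise is fixed. Raising it, and raising the noise of the one test that ends the epoch,
maps the noises giving an outcome list for one database to noises giving it for a neighbour; with
exponential noise the cost does not depend on the number of rounds (`epochProb_le`).

The epochs are composed through a moment of the likelihood ratio. On `[exp (-η), exp η]` the power
`r ^ (s + 1)` lies below its chord, which is affine. A product of affine forms in the epoch
probabilities expands into hybrid interactions, each of total probability 1 (`sum_prod_mix_eq`), so
the moment of the whole interaction is at most the `c`-th power of the chord at 1. A Markov-type
bound converts this into `(ε, δ)`-privacy (`history_private`).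

For swap regret, multiplicative weights run over the `k ^ k` maps of the actions, and the play is an
approximate fixed point of the current mixture of maps. The loss of the play is then nearly the loss
of the mixture, which competes with every single map (`swapAlgorithm_regret_le`). -/

/-- The exponential distribution with mean `1`. -/
noncomputable def unitExp : Measure ℝ := ProbabilityTheory.expMeasure 1

instance : IsProbabilityMeasure unitExp :=
  ProbabilityTheory.isProbabilityMeasure_expMeasure one_pos

theorem unitExp_apply {s : Set ℝ} (hs : MeasurableSet s) :
    unitExp s = ∫⁻ x, s.indicator (ProbabilityTheory.exponentialPDF 1) x := by
  rw [lintegral_indicator hs]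
  exact withDensity_apply _ hs

/-- The density satisfies `exp (-x) = exp a * exp (-(x + a))`: an upward shift by `a` multiplies it
by `exp a` and empties the region below `a`. The privacy argument shifts only upwards, so one-sided
noise suffices. -/
theorem unitExp_preimage_add {a : ℝ} (ha : 0 ≤ a) {s : Set ℝ} (hs : MeasurableSet s) :
    unitExp ((fun x => x + a) ⁻¹' s) =
      ENNReal.ofReal (Real.exp a) * unitExp (s ∩ Set.Ici a) := by
  have hm : Measurable (ProbabilityTheory.exponentialPDF 1) :=
    (ProbabilityTheory.measurable_exponentialPDFReal 1).ennreal_ofReal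
  have hs' : MeasurableSet ((fun x => x + a) ⁻¹' s) := hs.preimage (measurable_id.add_const a)
  rw [unitExp_apply hs', unitExp_apply (hs.inter measurableSet_Ici),
    ← lintegral_const_mul _ (hm.indicator (hs.inter measurableSet_Ici)),
    ← lintegral_sub_right_eq_self _ a]
  refine lintegral_congr fun x => ?_
  by_cases hx : x ∈ s
  · by_cases hxa : a ≤ x
    · simp only [Set.indicator, Set.mem_preimage, sub_add_cancel, hx, if_true, Set.mem_inter_iff,
        Set.mem_Ici, hxa, and_self]
      rw [ProbabilityTheory.exponentialPDF_of_nonneg (sub_nonneg.2 hxa),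
        ProbabilityTheory.exponentialPDF_of_nonneg (ha.trans hxa),
        ← ENNReal.ofReal_mul (Real.exp_pos _).le]
      congr 1
      rw [one_mul, one_mul, one_mul, one_mul, ← Real.exp_add]
      congr 1
      ring
    · simp only [Set.indicator, Set.mem_preimage, sub_add_cancel, hx, if_true, Set.mem_inter_iff,
        Set.mem_Ici, hxa, and_false, if_false, mul_zero]
      exact ProbabilityTheory.exponentialPDF_of_neg (by linarith)
  · simp [Set.indicator, hx]

theorem unitExp_Iio_zero : unitExp (Set.Iio 0) = 0 := by
  rw [unitExp_apply measurableSet_Iio]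
  refine (lintegral_congr fun x => ?_).trans lintegral_zero
  by_cases hx : x < 0
  · simp [Set.indicator, hx, ProbabilityTheory.exponentialPDF_of_neg hx]
  · simp [Set.indicator, hx]

theorem unitExp_Ici_le {a : ℝ} (ha : 0 ≤ a) :
    unitExp (Set.Ici a) ≤ ENNReal.ofReal (Real.exp (-a)) := by
  have h := unitExp_preimage_add ha (measurableSet_Ici (a := a))
  rw [Set.inter_self] at h
  have h1 : unitExp ((fun x => x + a) ⁻¹' Set.Ici a) ≤ 1 := prob_le_one
  rw [h] at h1
  calc unitExp (Set.Ici a)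
      = ENNReal.ofReal (Real.exp (-a)) * (ENNReal.ofReal (Real.exp a) * unitExp (Set.Ici a)) := by
        rw [← mul_assoc, ← ENNReal.ofReal_mul (Real.exp_pos _).le, ← Real.exp_add]
        simp
    _ ≤ ENNReal.ofReal (Real.exp (-a)) * 1 := by gcongr
    _ = _ := mul_one _

/-- The factors multiply over the coordinates, so the cost depends only on the total shift, not on
the number of coordinates. -/
theorem pi_unitExp_preimage_add_le {ι : Type*} [Fintype ι] {a : ι → ℝ} (ha : ∀ i, 0 ≤ a i)
    {s : Set (ι → ℝ)} (hs : MeasurableSet s) :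
    Measure.pi (fun _ : ι => unitExp) ((fun x => x + a) ⁻¹' s) ≤
      ENNReal.ofReal (Real.exp (∑ i, a i)) * Measure.pi (fun _ : ι => unitExp) s := by
  set μ := Measure.pi (fun _ : ι => unitExp)
  have key : (μ.map fun x => x + a) =
      ENNReal.ofReal (Real.exp (∑ i, a i)) • μ.restrict (Set.univ.pi fun i => Set.Ici (a i)) := by
    have hprob : ∀ i, IsProbabilityMeasure (unitExp.map fun x => x + a i) := fun i =>
      Measure.isProbabilityMeasure_map (measurable_id.add_const (a i)).aemeasurable
    have hmap : (μ.map fun x => x + a) = Measure.pi fun i => unitExp.map fun x => x + a i :=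
      Measure.pi_map_pi (μ := fun _ : ι => unitExp) (f := fun i x => x + a i)
        (fun i => (measurable_id.add_const (a i)).aemeasurable)
    rw [hmap]
    refine Measure.pi_eq (μ := fun i => unitExp.map fun x => x + a i) fun t ht => ?_
    rw [Measure.smul_apply, Measure.restrict_apply (MeasurableSet.univ_pi ht),
      ← Set.pi_inter_distrib, Measure.pi_pi, Real.exp_sum,
      ENNReal.ofReal_prod_of_nonneg fun i _ => (Real.exp_pos _).le, smul_eq_mul,
      ← Finset.prod_mul_distrib]
    refine Finset.prod_congr rfl fun i _ => ?_
    have hm : Measurable fun x => x + a i := measurable_id.add_const (a i)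
    rw [Measure.map_apply hm (ht i), unitExp_preimage_add (ha i) (ht i)]
  have hmeas : Measurable fun x : ι → ℝ => x + a := measurable_id.add_const a
  rw [← Measure.map_apply hmeas hs, key, Measure.smul_apply, smul_eq_mul]
  gcongr
  exact Measure.restrict_le_self

/-! ### A moment bound for likelihood ratios -/

/-- The slope of the chord of `x ↦ x ^ (s + 1)` over `[exp (-η), exp η]`. -/
noncomputable def chordSlope (η : ℝ) (s : ℕ) : ℝ :=
  (Real.exp η ^ (s + 1) - Real.exp (-η) ^ (s + 1)) / (Real.exp η - Real.exp (-η))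

/-- The value at `0` of the chord of `x ↦ x ^ (s + 1)` over `[exp (-η), exp η]`. -/
noncomputable def chordIntercept (η : ℝ) (s : ℕ) : ℝ :=
  Real.exp η ^ (s + 1) - chordSlope η s * Real.exp η

theorem pow_le_chord {η r : ℝ} (hη : 0 < η) (s : ℕ) (h1 : Real.exp (-η) ≤ r)
    (h2 : r ≤ Real.exp η) : r ^ (s + 1) ≤ chordIntercept η s + chordSlope η s * r := by
  have hlt : Real.exp (-η) < Real.exp η := Real.exp_lt_exp.2 (by linarith)
  have hd : 0 < Real.exp η - Real.exp (-η) := sub_pos.2 hlt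
  unfold chordIntercept chordSlope
  set x := Real.exp (-η) with hx
  set y := Real.exp η
  have hx0 : 0 ≤ x := (Real.exp_pos _).le
  have hy0 : 0 ≤ y := (Real.exp_pos _).le
  have hconv := (convexOn_pow (𝕜 := ℝ) (s + 1)).2 (Set.mem_Ici.2 hx0) (Set.mem_Ici.2 hy0)
    (show 0 ≤ (y - r) / (y - x) from div_nonneg (sub_nonneg.2 h2) hd.le)
    (show 0 ≤ (r - x) / (y - x) from div_nonneg (sub_nonneg.2 h1) hd.le)
    (by rw [← add_div, div_eq_one_iff_eq hd.ne']; ring)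
  simp only [smul_eq_mul] at hconv
  have he : (y - r) / (y - x) * x + (r - x) / (y - x) * y = r := by field_simp; ring
  rw [he] at hconv
  refine hconv.trans (le_of_eq ?_)
  field_simp
  ring

/-- The left side equals `cosh ((s + 1/2) η) / cosh (η / 2)`. The value of the chord at 1 matters
because a likelihood ratio has mean 1. -/
theorem chord_at_one_le {η : ℝ} (hη : 0 < η) (s : ℕ) :
    chordIntercept η s + chordSlope η s ≤ Real.exp (((s + 1 / 2) * η) ^ 2 / 2) := by
  refine le_trans ?_ (Real.cosh_le_exp_half_sq _)
  have hx1 : 1 < Real.exp (η / 2) := Real.one_lt_exp_iff.2 (by linarith)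
  have e1 : Real.exp η = Real.exp (η / 2) ^ 2 := by rw [← Real.exp_nat_mul]; congr 1; push_cast; ring
  have e2 : Real.exp η ^ (s + 1) = Real.exp ((s + 1 / 2) * η) * Real.exp (η / 2) := by
    rw [← Real.exp_nat_mul, ← Real.exp_add]; congr 1; push_cast; ring
  unfold chordIntercept chordSlope
  rw [Real.cosh_eq, Real.exp_neg, Real.exp_neg, inv_pow, e2, e1]
  set x := Real.exp (η / 2)
  set Y := Real.exp ((s + 1 / 2) * η)
  have hY : 0 < Y := Real.exp_pos _
  have hx : 0 < x := by linarith
  have hx4 : x ^ 2 - (x ^ 2)⁻¹ = (x ^ 2 - 1) * (x ^ 2 + 1) / x ^ 2 := by field_simp; ring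
  have hx2 : 0 < x ^ 2 - 1 := by nlinarith
  have : Y * x - (Y * x - (Y * x)⁻¹) / (x ^ 2 - (x ^ 2)⁻¹) * x ^ 2
      + (Y * x - (Y * x)⁻¹) / (x ^ 2 - (x ^ 2)⁻¹) = (Y + Y⁻¹) * (x / (x ^ 2 + 1)) := by
    rw [hx4]
    field_simp
    ring
  rw [this]
  have hle : x / (x ^ 2 + 1) ≤ 1 / 2 := by
    rw [div_le_div_iff₀ (by positivity) two_pos]; nlinarith [sq_nonneg (x - 1)]
  calc (Y + Y⁻¹) * (x / (x ^ 2 + 1)) ≤ (Y + Y⁻¹) * (1 / 2) := by gcongr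
    _ = _ := by ring

/-- This is `pow_le_chord` for the ratio `a / b`, multiplied by `b`. The bound is linear in the two
probabilities, which is what allows products to be expanded and summed. -/
theorem pow_div_pow_le_chord {η a b : ℝ} (hη : 0 < η) (s : ℕ) (ha : 0 ≤ a) (hb : 0 ≤ b)
    (hab : a ≤ Real.exp η * b) (hba : b ≤ Real.exp η * a) :
    a ^ (s + 1) / b ^ s ≤ chordIntercept η s * b + chordSlope η s * a := by
  rcases hb.eq_or_lt with rfl | hb
  · have : a = 0 := le_antisymm (by simpa using hab) ha
    simp [this]
  · have h := pow_le_chord hη s (r := a / b)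
      (by rw [le_div_iff₀ hb, Real.exp_neg, inv_mul_le_iff₀ (Real.exp_pos _)]; exact hba)
      (by rwa [div_le_iff₀ hb])
    calc a ^ (s + 1) / b ^ s = (a / b) ^ (s + 1) * b := by rw [div_pow, pow_succ b]; field_simp
      _ ≤ (chordIntercept η s + chordSlope η s * (a / b)) * b := by gcongr
      _ = _ := by field_simp

/-- A pointwise Markov inequality: where `a` exceeds `exp ε * b`, the factor `exp (-(s * ε)) * (a /
b) ^ s` is at least 1. -/
theorem le_exp_mul_add_pow_div_pow {ε a b : ℝ} (s : ℕ) (ha : 0 ≤ a) (hb : 0 ≤ b)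
    (hab : b = 0 → a = 0) :
    a ≤ Real.exp ε * b + Real.exp (-(s * ε)) * (a ^ (s + 1) / b ^ s) := by
  rcases hb.eq_or_lt with rfl | hb
  · simp [hab rfl]
  · rcases le_total a (Real.exp ε * b) with h | h
    · exact h.trans (le_add_of_nonneg_right (by positivity))
    · refine le_trans ?_ (le_add_of_nonneg_left (by positivity))
      have h2 : Real.exp (s * ε) ≤ (a / b) ^ s := by
        rw [Real.exp_nat_mul]
        gcongr
        rwa [le_div_iff₀ hb]
      calc a = Real.exp (-(s * ε)) * (a * Real.exp (s * ε)) := by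
            rw [Real.exp_neg]; field_simp
        _ ≤ Real.exp (-(s * ε)) * (a * (a / b) ^ s) := by gcongr
        _ = _ := by rw [div_pow, pow_succ]; ring

theorem log_four_div_ge {δ : ℝ} (hδ : δ ∈ Set.Ioc (0 : ℝ) 1) :
    2 * Real.log 2 ≤ Real.log (4 / δ) := by
  have h4 : Real.log 4 = 2 * Real.log 2 := by
    rw [show (4 : ℝ) = 2 ^ 2 by norm_num, Real.log_pow]; norm_num
  rw [← h4]
  refine Real.log_le_log (by norm_num) ?_
  rw [le_div_iff₀ hδ.1]
  linarith [hδ.2]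

/-- The tail bound behind the composition of `c` mechanisms, each of them `η`-private. -/
theorem exists_exp_mul_pow_le {ε δ η : ℝ} (c : ℕ) (hε : ε ∈ Set.Ioc (0 : ℝ) 1)
    (hδ : δ ∈ Set.Ioc (0 : ℝ) 1) (hc : c * η ^ 2 ≤ ε ^ 2 / (2 * Real.log (4 / δ))) :
    ∃ s : ℕ, Real.exp (-(s * ε)) * Real.exp (((s + 1 / 2) * η) ^ 2 / 2) ^ c ≤ δ := by
  have hL := log_four_div_ge hδ
  have hlog2 := Real.log_two_gt_d9
  set L := Real.log (4 / δ) with hLdef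
  have hL0 : 0 < L := by linarith
  have hδL : δ = Real.exp (2 * Real.log 2 - L) := by
    have h4 : Real.exp (2 * Real.log 2) = 4 := by
      rw [show (2 : ℝ) * Real.log 2 = Real.log 2 + Real.log 2 by ring, Real.exp_add,
        Real.exp_log two_pos]; norm_num
    rw [Real.exp_sub, hLdef, Real.exp_log (div_pos (by norm_num) hδ.1), h4]
    field_simp
  -- The exponent is about `-sε + (sε)² / (4L)`, which is minimal at `sε = 2L` with value `-L`.
  -- Rounding up and the shift by 1/2 cost at most 1.2, less than the slack `2 log 2` provided by
  -- the 4 in `log (4 / δ)`.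
  refine ⟨⌈2 * L / ε⌉₊, ?_⟩
  set s := ⌈2 * L / ε⌉₊
  have hs1 : 2 * L ≤ s * ε := by
    have := Nat.le_ceil (2 * L / ε); rwa [div_le_iff₀ hε.1] at this
  have hs2 : s * ε ≤ 2 * L + ε := by
    have := (Nat.ceil_lt_add_one (show 0 ≤ 2 * L / ε by have := hε.1; positivity)).le
    calc s * ε ≤ (2 * L / ε + 1) * ε := by have := hε.1; gcongr
      _ = _ := by have := hε.1.ne'; field_simp
  rw [← Real.exp_nat_mul, ← Real.exp_add, hδL, Real.exp_le_exp]
  have h1 : (c : ℝ) * (((s + 1 / 2) * η) ^ 2 / 2) ≤ (s * ε + ε / 2) ^ 2 / (4 * L) := by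
    calc (c : ℝ) * (((s + 1 / 2) * η) ^ 2 / 2) = (s + 1 / 2) ^ 2 / 2 * (c * η ^ 2) := by ring
      _ ≤ (s + 1 / 2) ^ 2 / 2 * (ε ^ 2 / (2 * L)) := by gcongr
      _ = _ := by field_simp; ring
  have h2 : (s * ε + ε / 2) ^ 2 / (4 * L) ≤ s * ε - L + 1.2 := by
    rw [div_le_iff₀ (by positivity)]
    obtain ⟨u, hu⟩ : ∃ u, s * ε = 2 * L + u := ⟨s * ε - 2 * L, by ring⟩
    have hu0 : 0 ≤ u := by linarith
    have hu1 : u ≤ ε := by linarith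
    have := hε.1
    have := hε.2
    rw [hu]
    have : (u + ε / 2) ^ 2 ≤ (3 / 2) ^ 2 := by
      apply pow_le_pow_left₀ <;> linarith
    nlinarith
  linarith

end LargeGame

/-! ### Adaptive threshold tests

A *history* is the list, latest first, of the outcomes of the tests performed so far. An outcome
`none` ends a round; an outcome `some _` ends an epoch, i.e. a period with fixed threshold noise. -/

namespace LargeGame

/-- The histories of the threshold tests. -/
abbrev History : Type := List (Option Bool)

/-- The number of epochs that have been completed. -/
def History.epoch (h : History) : ℕ := h.countP Option.isSome

/-- The number of rounds that have been completed. -/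
def History.rounds (h : History) : ℕ := h.countP Option.isNone

namespace History

@[simp] theorem epoch_nil : epoch [] = 0 := rfl
@[simp] theorem rounds_nil : rounds [] = 0 := rfl
@[simp] theorem epoch_none (h : History) : epoch (none :: h) = epoch h := by simp [epoch]
@[simp] theorem epoch_some (b : Bool) (h : History) : epoch (some b :: h) = epoch h + 1 := by
  simp [epoch]
@[simp] theorem rounds_none (h : History) : rounds (none :: h) = rounds h + 1 := by simp [rounds]
@[simp] theorem rounds_some (b : Bool) (h : History) : rounds (some b :: h) = rounds h := by
  simp [rounds]

theorem epoch_le_cons (o : Option Bool) (h : History) : epoch h ≤ epoch (o :: h) := by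
  cases o <;> simp

theorem rounds_le_cons (o : Option Bool) (h : History) : rounds h ≤ rounds (o :: h) := by
  cases o <;> simp

/-- Every test ends either a round or an epoch. Hence `R + c` tests complete `R` rounds if at most
`c` of them end an epoch. -/
theorem epoch_add_rounds (h : History) : epoch h + rounds h = h.length := by
  induction h with
  | nil => rfl
  | cons o h ih => cases o <;> simp <;> omega

end History

open History

/-- The noise of one epoch: the one of the threshold and, for every round, the two of the tests. -/
abbrev EpochNoise (R : ℕ) : Type := Option (Fin R × Bool) → ℝ

/-- The noise of `c` epochs. -/
abbrev Noise (c R : ℕ) : Type := Fin c → EpochNoise R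

/-- The distribution of the noise of one epoch. -/
noncomputable def epochNoiseMeasure (R : ℕ) : Measure (EpochNoise R) :=
  Measure.pi fun _ => unitExp

/-- The distribution of the noise. -/
noncomputable def noiseMeasure (c R : ℕ) : Measure (Noise c R) :=
  Measure.pi fun _ => epochNoiseMeasure R

instance (R : ℕ) : IsProbabilityMeasure (epochNoiseMeasure R) := by
  unfold epochNoiseMeasure; infer_instance

instance (c R : ℕ) : IsProbabilityMeasure (noiseMeasure c R) := by
  unfold noiseMeasure; infer_instance

/-- The outcome of comparing `d` and `-d` with the noisy threshold. -/
noncomputable def testOutcome {R : ℕ} (th b : ℝ) (x : EpochNoise R) (r : Fin R) (d : ℝ) :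
    Option Bool :=
  if th + b * x none ≤ d + b * x (some (r, true)) then some true
  else if th + b * x none ≤ -d + b * x (some (r, false)) then some false
  else none

theorem testOutcome_eq_none {R : ℕ} {th b : ℝ} {x : EpochNoise R} {r : Fin R} {d : ℝ} :
    testOutcome th b x r d = none ↔ d + b * x (some (r, true)) < th + b * x none ∧
      -d + b * x (some (r, false)) < th + b * x none := by
  unfold testOutcome
  split_ifs <;> simp <;> grind

theorem testOutcome_eq_true {R : ℕ} {th b : ℝ} {x : EpochNoise R} {r : Fin R} {d : ℝ} :
    testOutcome th b x r d = some true ↔ th + b * x none ≤ d + b * x (some (r, true)) := by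
  unfold testOutcome
  split_ifs <;> simp <;> grind

theorem testOutcome_eq_false {R : ℕ} {th b : ℝ} {x : EpochNoise R} {r : Fin R} {d : ℝ} :
    testOutcome th b x r d = some false ↔ d + b * x (some (r, true)) < th + b * x none ∧
      th + b * x none ≤ -d + b * x (some (r, false)) := by
  unfold testOutcome
  split_ifs <;> simp <;> grind

theorem measurable_testOutcome {R : ℕ} (th b : ℝ) (r : Fin R) {Ω : Type*} [MeasurableSpace Ω]
    {x : Ω → EpochNoise R} (hx : Measurable x) {d : Ω → ℝ} (hd : Measurable d) :
    @Measurable _ _ _ ⊤ fun ω => testOutcome th b (x ω) r (d ω) := by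
  let _ : MeasurableSpace (Option Bool) := ⊤
  have hc : ∀ i, Measurable fun ω => x ω i := fun i => (measurable_pi_apply i).comp hx
  have ht : Measurable fun ω => th + b * x ω none := ((hc _).const_mul b).const_add th
  exact Measurable.ite (measurableSet_le ht (hd.add ((hc _).const_mul b))) measurable_const
    (Measurable.ite (measurableSet_le ht (hd.neg.add ((hc _).const_mul b))) measurable_const
      measurable_const)

/-! ### Product structure of the histories over the epochs -/

section Histories

variable {c R : ℕ} (th b : ℝ)

/-- The next outcome after the history `h`; the tests are only performed in the first `c` epochs
and the first `R` rounds. -/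
noncomputable def nextOutcome (d : History → ℝ) (ω : Noise c R) (h : History) : Option Bool :=
  if H : epoch h < c ∧ rounds h < R then
    testOutcome th b (ω ⟨epoch h, H.1⟩) ⟨rounds h, H.2⟩ (d h)
  else none

/-- The history of the first `j` tests, the test after the history `h` being about `d h`. -/
noncomputable def history (d : History → ℝ) (ω : Noise c R) : ℕ → History
  | 0 => []
  | j + 1 => nextOutcome th b d ω (history d ω j) :: history d ω j

theorem history_length (d : History → ℝ) (ω : Noise c R) (j : ℕ) :
    (history th b d ω j).length = j := by
  induction j with
  | zero => rfl
  | succ j ih => simp [history, ih]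

variable (c R) in
/-- All the outcomes of tests that are not performed are `none`. -/
def Feasible : History → Prop
  | [] => True
  | o :: h => Feasible h ∧ (epoch h < c ∧ rounds h < R ∨ o = none)

/-- The noises of epoch `e` with which the history `w` is possible. -/
def consistent (d : History → ℝ) (e : ℕ) : History → Set (EpochNoise R)
  | [] => Set.univ
  | o :: h => consistent d e h ∩
      {x | ∀ H : epoch h = e ∧ rounds h < R, testOutcome th b x ⟨rounds h, H.2⟩ (d h) = o}

/-- Once `w` is fixed, each test recorded in it reads the noise of a single known epoch. The event
therefore splits into separate conditions on the independent `ω e`, although the tests are adaptive.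
-/
theorem history_eq_iff (d : History → ℝ) (ω : Noise c R) (w : History) :
    history th b d ω w.length = w ↔
      Feasible c R w ∧ ∀ e : Fin c, ω e ∈ consistent th b d e w := by
  induction w with
  | nil => simp [history, Feasible, consistent]
  | cons o h ih =>
    have h1 : history th b d ω (o :: h).length = o :: h ↔
        history th b d ω h.length = h ∧ nextOutcome th b d ω h = o := by
      simp only [List.length_cons, history, List.cons.injEq]
      constructor
      · rintro ⟨h1, h2⟩; rw [h2] at h1; exact ⟨h2, h1⟩
      · rintro ⟨h1, h2⟩; rw [h1]; exact ⟨h2, rfl⟩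
    rw [h1, ih]
    simp only [Feasible, consistent, Set.mem_inter_iff, Set.mem_ofPred_eq, forall_and]
    have h2 : nextOutcome th b d ω h = o ↔ (epoch h < c ∧ rounds h < R ∨ o = none) ∧
        ∀ (e : Fin c) (H : epoch h = e ∧ rounds h < R),
          testOutcome th b (ω e) ⟨rounds h, H.2⟩ (d h) = o := by
      unfold nextOutcome
      split_ifs with H
      · constructor
        · intro h3
          refine ⟨Or.inl H, fun e He => ?_⟩
          have : e = ⟨epoch h, H.1⟩ := Fin.ext He.1.symm
          subst this; exact h3
        · rintro ⟨-, h3⟩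
          exact h3 ⟨epoch h, H.1⟩ ⟨rfl, H.2⟩
      · constructor
        · rintro rfl
          exact ⟨Or.inr rfl, fun e He => (H ⟨He.1 ▸ e.2, He.2⟩).elim⟩
        · rintro ⟨h3 | h3, -⟩
          · exact (H h3).elim
          · exact h3.symm
    rw [h2]
    tauto

theorem measurableSet_consistent (d : History → ℝ) (e : ℕ) (w : History) :
    MeasurableSet (consistent (R := R) th b d e w) := by
  induction w with
  | nil => exact MeasurableSet.univ
  | cons o h ih =>
    refine ih.inter ?_
    by_cases H : epoch h = e ∧ rounds h < R
    · simp only [H, and_self, forall_true_left]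
      let _ : MeasurableSpace (Option Bool) := ⊤
      exact measurable_testOutcome th b ⟨rounds h, H.2⟩ measurable_id
        (measurable_const (a := d h)) (MeasurableSpace.measurableSet_top (s := {o}))
    · have : {x : EpochNoise R | ∀ H : epoch h = e ∧ rounds h < R,
          testOutcome th b x ⟨rounds h, H.2⟩ (d h) = o} = Set.univ := by
        ext x; simp only [Set.mem_ofPred_eq, Set.mem_univ, iff_true]; exact fun H' => (H H').elim
      rw [this]; exact MeasurableSet.univ

theorem setOf_history_eq [DecidablePred (Feasible c R)] (d : History → ℝ) (w : History) :
    {ω : Noise c R | history th b d ω w.length = w} =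
      if Feasible c R w then Set.univ.pi fun e : Fin c => consistent th b d e w else ∅ := by
  ext ω
  rw [Set.mem_ofPred_eq, history_eq_iff]
  split_ifs with h <;> simp [h]

/-- The probability that epoch `e` agrees with the history `w`. -/
noncomputable def epochProb (R : ℕ) (d : History → ℝ) (e : ℕ) (w : History) : ℝ :=
  (epochNoiseMeasure R).real (consistent th b d e w)

theorem measureReal_history_eq [DecidablePred (Feasible c R)] (d : History → ℝ) (w : History) :
    (noiseMeasure c R).real {ω | history th b d ω w.length = w} =
      if Feasible c R w then ∏ e : Fin c, epochProb th b R d e w else 0 := by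
  rw [setOf_history_eq]
  split_ifs with h
  · rw [measureReal_def, noiseMeasure, Measure.pi_pi, ENNReal.toReal_prod]
    rfl
  · simp

theorem measurableSet_history_eq (d : History → ℝ) (w : History) :
    MeasurableSet {ω : Noise c R | history th b d ω w.length = w} := by
  classical
  rw [setOf_history_eq]
  split_ifs
  · exact MeasurableSet.univ_pi fun e => measurableSet_consistent th b d e w
  · exact MeasurableSet.empty

/-- While epoch `e` is still open, only its threshold noise and the noises of completed rounds have
been read. The noise of the current round can thus be changed without disturbing the past. -/
theorem consistent_congr (d : History → ℝ) {e : ℕ} {x y : EpochNoise R} (h0 : x none = y none) :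
    ∀ w : History, epoch w ≤ e →
      (∀ (r : Fin R) (s : Bool), (r : ℕ) < rounds w → x (some (r, s)) = y (some (r, s))) →
      x ∈ consistent th b d e w → y ∈ consistent th b d e w
  | [], _, _, _ => trivial
  | o :: h, he, hxy, hx => by
    refine ⟨consistent_congr d h0 h ((epoch_le_cons o h).trans he)
      (fun r s hr => hxy r s (hr.trans_le (rounds_le_cons o h))) hx.1, fun H => ?_⟩
    cases o with
    | some s => simp at he; omega
    | none =>
      rw [← hx.2 H]
      unfold testOutcome
      rw [h0, hxy _ _ (by simp), hxy _ _ (by simp)]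

/-! ### Privacy of a single epoch -/

/-- The shift of the noise of the threshold by `s`. -/
def thresholdShift (R : ℕ) (s : ℝ) : EpochNoise R := Pi.single none s

@[simp] theorem thresholdShift_none (R : ℕ) (s : ℝ) : thresholdShift R s none = s := by
  simp [thresholdShift]

@[simp] theorem thresholdShift_some (R : ℕ) (s : ℝ) (j : Fin R × Bool) :
    thresholdShift R s (some j) = 0 := by simp [thresholdShift]

variable {th b} {d d' : History → ℝ} {s : ℝ}

/-- Raising the threshold by `b * s` outweighs any change of `d` and `-d` by at most `b * s`, so
every test that failed still fails. -/
theorem add_thresholdShift_mem_consistent (hd : ∀ h, |d h - d' h| ≤ b * s) {e : ℕ}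
    {x : EpochNoise R} : ∀ w : History, epoch w ≤ e → x ∈ consistent th b d e w →
      x + thresholdShift R s ∈ consistent th b d' e w
  | [], _, _ => trivial
  | o :: h, he, hx => by
    refine ⟨add_thresholdShift_mem_consistent hd h ((epoch_le_cons o h).trans he) hx.1,
      fun H => ?_⟩
    cases o with
    | some s => simp at he; omega
    | none =>
      have h1 := testOutcome_eq_none.1 (hx.2 H)
      have h2 := abs_le.1 (hd h)
      rw [testOutcome_eq_none]
      simp only [Pi.add_apply, thresholdShift_none, thresholdShift_some, mul_add, mul_zero]
      constructor <;> linarith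

/-- Besides the shift of the threshold, only the one successful test that closes the epoch needs
compensation. The total shift `3 * s` does not grow with the number of failed tests. -/
theorem exists_shift_consistent (hs : 0 ≤ s) (hd : ∀ h, |d h - d' h| ≤ b * s) (e : ℕ) :
    ∀ w : History, ∃ a : EpochNoise R, (∀ i, 0 ≤ a i) ∧ ∑ i, a i ≤ 3 * s ∧
      consistent th b d e w ⊆ (fun x => x + a) ⁻¹' consistent th b d' e w := by
  have hsum : ∑ i, thresholdShift R s i = s := by simp [thresholdShift]
  have hnn : ∀ i, 0 ≤ thresholdShift R s i := fun i => by cases i <;> simp [hs]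
  intro w
  by_cases hw : epoch w ≤ e
  · exact ⟨thresholdShift R s, hnn, by rw [hsum]; linarith,
      fun x hx => add_thresholdShift_mem_consistent hd w hw hx⟩
  induction w with
  | nil => simp at hw
  | cons o h ih =>
    by_cases hh : epoch h ≤ e
    · have he : epoch h = e := by
        cases o <;> simp at hw <;> omega
      cases o with
      | none => simp at hw; omega
      | some sd =>
        by_cases hr : rounds h < R
        · have hsum' : ∑ i, (thresholdShift R s +
              Pi.single (some ((⟨rounds h, hr⟩ : Fin R), sd)) (2 * s) : EpochNoise R) i
              = 3 * s := by
            simp only [Pi.add_apply, Finset.sum_add_distrib, hsum]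
            rw [Finset.sum_pi_single']
            simp; ring
          -- Of the extra `2 * s`, one half follows the raised threshold and the other half offsets
          -- the change of `d`.
          refine ⟨thresholdShift R s + Pi.single (some ((⟨rounds h, hr⟩ : Fin R), sd)) (2 * s), fun i => ?_,
            hsum'.le, fun x hx => ⟨?_, fun H => ?_⟩⟩
          · refine add_nonneg (hnn i) ?_
            rw [Pi.single_apply]; split_ifs <;> linarith
          · refine consistent_congr th b d' ?_ h hh ?_
              (add_thresholdShift_mem_consistent hd h hh hx.1)
            · simp
            · intro r s' hr'
              have : r ≠ ⟨rounds h, hr⟩ := fun h' => by rw [h'] at hr'; simp at hr'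
              simp [this]
          · have h1 := hx.2 ⟨he, hr⟩
            have h2 := abs_le.1 (hd h)
            cases sd with
            | true =>
              rw [testOutcome_eq_true] at h1 ⊢
              simp only [Pi.add_apply, thresholdShift_none, thresholdShift_some, Pi.single_eq_same,
                Pi.single_eq_of_ne (Option.some_ne_none _).symm, mul_add]
              linarith
            | false =>
              rw [testOutcome_eq_false] at h1 ⊢
              simp only [Pi.add_apply, thresholdShift_none, thresholdShift_some, Pi.single_eq_same,
                Pi.single_eq_of_ne (Option.some_ne_none _).symm, mul_add]
              rw [Pi.single_eq_of_ne (by simp)]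
              constructor <;> linarith
        · exact ⟨thresholdShift R s, hnn, by rw [hsum]; linarith, fun x hx =>
            ⟨add_thresholdShift_mem_consistent hd h hh hx.1, fun H => (hr H.2).elim⟩⟩
    -- Tests made after the end of epoch `e` put no condition on its noise.
    · obtain ⟨a, ha, hsum, hsub⟩ := ih hh
      exact ⟨a, ha, hsum, fun x hx => ⟨hsub hx.1, fun H => (hh H.1.le).elim⟩⟩

theorem epochProb_le (hs : 0 ≤ s) (hd : ∀ h, |d h - d' h| ≤ b * s) (e : ℕ) (w : History) :
    epochProb th b R d e w ≤ Real.exp (3 * s) * epochProb th b R d' e w := by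
  obtain ⟨a, ha, hsum, hsub⟩ := exists_shift_consistent (R := R) (th := th) hs hd e w
  have h1 : epochNoiseMeasure R (consistent th b d e w) ≤
      ENNReal.ofReal (Real.exp (3 * s)) * epochNoiseMeasure R (consistent th b d' e w) := by
    refine (measure_mono hsub).trans
      ((pi_unitExp_preimage_add_le ha (measurableSet_consistent th b d' e w)).trans ?_)
    unfold epochNoiseMeasure
    gcongr
  have h2 := ENNReal.toReal_mono (ENNReal.mul_ne_top ENNReal.ofReal_ne_top (measure_ne_top _ _)) h1
  rwa [ENNReal.toReal_mul, ENNReal.toReal_ofReal (Real.exp_pos _).le] at h2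

/-! ### Composition of the epochs -/

/-- The histories of length `N`. -/
noncomputable def histories (N : ℕ) : Finset History :=
  (List.finite_length_eq (Option Bool) N).toFinset

theorem mem_histories {N : ℕ} {w : History} : w ∈ histories N ↔ w.length = N := by
  simp [histories]

variable (th b)

theorem measurable_history (d : History → ℝ) (N : ℕ) :
    @Measurable _ _ _ ⊤ fun ω : Noise c R => history th b d ω N := by
  let _ : MeasurableSpace History := ⊤
  refine measurable_to_countable' fun w => ?_
  by_cases hw : w.length = N
  · subst hw; exact measurableSet_history_eq th b d w
  · convert! MeasurableSet.empty
    ext ω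
    simp only [Set.mem_preimage, Set.mem_singleton_iff, Set.mem_empty_iff_false, iff_false]
    exact fun h => hw (h ▸ history_length th b d ω N)

theorem measureReal_history_mem (d : History → ℝ) (N : ℕ) (E : Finset History)
    (hE : E ⊆ histories N) :
    (noiseMeasure c R).real {ω | history th b d ω N ∈ E} =
      ∑ w ∈ E, (noiseMeasure c R).real {ω | history th b d ω w.length = w} := by
  let _ : MeasurableSpace History := ⊤
  have h := sum_measureReal_preimage_singleton (μ := noiseMeasure c R) E
    (f := fun ω => history th b d ω N)
    (fun w _ => measurable_history th b d N (MeasurableSpace.measurableSet_top (s := {w})))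
  refine Eq.trans ?_ (h.symm.trans (Finset.sum_congr rfl fun w hw => ?_))
  · rfl
  · rw [mem_histories.1 (hE hw)]; rfl

theorem sum_prod_epochProb_eq_one [DecidablePred (Feasible c R)] (d : History → ℝ) (N : ℕ) :
    ∑ w ∈ histories N with Feasible c R w, ∏ e : Fin c, epochProb th b R d e w = 1 := by
  rw [Finset.sum_filter]
  simp_rw [← measureReal_history_eq]
  rw [← measureReal_history_mem th b d N _ subset_rfl]
  convert! probReal_univ (μ := noiseMeasure c R)
  ext ω
  simp [mem_histories, history_length]

/-- The conditions on epoch `e` involve `d` only at histories of epoch `e`. Using `d` in some epochs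
and `d'` in the others is thus again an interaction of the same kind. -/
theorem consistent_piecewise {t : Set ℕ} [DecidablePred (· ∈ t)] (d d' : History → ℝ) (e : ℕ)
    (w : History) :
    consistent (R := R) th b (fun h => if epoch h ∈ t then d h else d' h) e w =
      consistent th b (if e ∈ t then d else d') e w := by
  induction w with
  | nil => rfl
  | cons o h ih =>
    simp only [consistent, ih]
    congr 1
    ext x
    refine forall_congr' fun H => ?_
    rw [H.1]
    split_ifs <;> rfl

/-- The identity behind composition: a product of mixtures of epoch probabilities is a mixture of
the distributions of hybrid interactions. -/
theorem sum_prod_mix_eq [DecidablePred (Feasible c R)] (d d' : History → ℝ) (N : ℕ) (x y : ℝ) :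
    ∑ w ∈ histories N with Feasible c R w,
      ∏ e : Fin c, (x * epochProb th b R d' e w + y * epochProb th b R d e w) = (x + y) ^ c := by
  classical
  -- The product is the probability of `w` in the hybrid that uses `d'` exactly in the epochs of
  -- `t`.
  have h1 : ∀ t : Finset (Fin c), ∑ w ∈ histories N with Feasible c R w,
      (∏ e ∈ t, epochProb th b R d' e w) * ∏ e ∈ Finset.univ \ t, epochProb th b R d e w = 1 := by
    intro t
    rw [← sum_prod_epochProb_eq_one (c := c) (R := R) th b
      (fun h => if epoch h ∈ ((↑) : Fin c → ℕ) '' t then d' h else d h) N]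
    refine Finset.sum_congr rfl fun w _ => ?_
    have h2 : ∀ e : Fin c, epochProb th b R
        (fun h => if epoch h ∈ ((↑) : Fin c → ℕ) '' t then d' h else d h) e w =
        if e ∈ t then epochProb th b R d' e w else epochProb th b R d e w := by
      intro e
      unfold epochProb
      rw [consistent_piecewise]
      have : (e : ℕ) ∈ ((↑) : Fin c → ℕ) '' t ↔ e ∈ t := by simp [Fin.val_inj]
      simp only [this]
      split_ifs <;> rfl
    simp_rw [h2]
    rw [Finset.prod_ite]
    congr 1
    · congr 1; ext; simp
    · congr 1; ext; simp
  calc _ = ∑ w ∈ histories N with Feasible c R w, ∑ t ∈ (Finset.univ : Finset (Fin c)).powerset,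
        (∏ e ∈ t, x) * (∏ e ∈ Finset.univ \ t, y) *
        ((∏ e ∈ t, epochProb th b R d' e w) *
          ∏ e ∈ Finset.univ \ t, epochProb th b R d e w) := by
        refine Finset.sum_congr rfl fun w _ => ?_
        rw [Finset.prod_add]
        refine Finset.sum_congr rfl fun t _ => ?_
        rw [Finset.prod_mul_distrib, Finset.prod_mul_distrib]
        ring
    _ = ∑ t ∈ (Finset.univ : Finset (Fin c)).powerset,
        (∏ e ∈ t, x) * (∏ e ∈ Finset.univ \ t, y) := by
        rw [Finset.sum_comm]
        refine Finset.sum_congr rfl fun t _ => ?_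
        rw [← Finset.mul_sum, h1, mul_one]
    _ = _ := by
        rw [← Finset.prod_add, Finset.prod_const, Finset.card_univ, Fintype.card_fin]

variable {th b}

/-- The threshold tests are differentially private. -/
theorem history_private {lam η ε δ : ℝ} (hη : 0 < c → 0 < η ∧ b * η = 3 * lam)
    (hε : ε ∈ Set.Ioc (0 : ℝ) 1) (hδ : δ ∈ Set.Ioc (0 : ℝ) 1)
    (hc : c * η ^ 2 ≤ ε ^ 2 / (2 * Real.log (4 / δ)))
    (hd : ∀ h, |d h - d' h| ≤ lam) (N : ℕ) (E : Set History) :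
    noiseMeasure c R {ω | history th b d ω N ∈ E} ≤
      ENNReal.ofReal (Real.exp ε) * noiseMeasure c R {ω | history th b d' ω N ∈ E}
        + ENNReal.ofReal δ := by
  classical
  obtain ⟨s, hs⟩ := exists_exp_mul_pow_le c hε hδ hc
  have hle : ∀ d d' : History → ℝ, (∀ h, |d h - d' h| ≤ lam) → ∀ (e : Fin c) w,
      epochProb th b R d e w ≤ Real.exp η * epochProb th b R d' e w := by
    intro d d' hd e w
    obtain ⟨hη0, hbη⟩ := hη (Fin.pos e)
    have h := epochProb_le (R := R) (th := th) (b := b) (s := η / 3) (by positivity)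
      (fun h => (hd h).trans (by linarith)) e w
    rwa [mul_div_cancel₀ _ (by norm_num)] at h
  have hdsymm : ∀ h, |d' h - d h| ≤ lam := fun h => by rw [abs_sub_comm]; exact hd h
  have hnn : ∀ (d : History → ℝ) (e : Fin c) w, 0 ≤ epochProb th b R d e w :=
    fun _ _ _ => measureReal_nonneg
  set F : Finset History := (histories N).filter (· ∈ E) with hF
  have hFsub : F ⊆ histories N := Finset.filter_subset _ _
  have hset : ∀ d : History → ℝ, {ω : Noise c R | history th b d ω N ∈ E} =
      {ω | history th b d ω N ∈ F} := by
    intro d; ext ω; simp [hF, mem_histories, history_length]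
  have hsum : ∀ d : History → ℝ, (noiseMeasure c R).real {ω | history th b d ω N ∈ F} =
      ∑ w ∈ F with Feasible c R w, ∏ e : Fin c, epochProb th b R d e w := by
    intro d
    rw [measureReal_history_mem th b d N F hFsub]
    exact (Finset.sum_congr rfl fun w _ => measureReal_history_eq th b d w).trans
      (Finset.sum_filter _ _).symm
  have hmoment : ∑ w ∈ F with Feasible c R w, (∏ e : Fin c, epochProb th b R d e w) ^ (s + 1) /
      (∏ e : Fin c, epochProb th b R d' e w) ^ s ≤ Real.exp (((s + 1 / 2) * η) ^ 2 / 2) ^ c := by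
    have hterm : ∀ w, (∏ e : Fin c, epochProb th b R d e w) ^ (s + 1) /
        (∏ e : Fin c, epochProb th b R d' e w) ^ s ≤ ∏ e : Fin c,
        (chordIntercept η s * epochProb th b R d' e w
          + chordSlope η s * epochProb th b R d e w) := by
      intro w
      rw [← Finset.prod_pow, ← Finset.prod_pow, ← Finset.prod_div_distrib]
      exact Finset.prod_le_prod (fun e _ => div_nonneg (pow_nonneg (hnn _ _ _) _)
        (pow_nonneg (hnn _ _ _) _)) fun e _ => pow_div_pow_le_chord (hη (Fin.pos e)).1 s
        (hnn _ _ _) (hnn _ _ _) (hle d d' hd e w) (hle d' d hdsymm e w)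
    have hterm0 : ∀ w, 0 ≤ (∏ e : Fin c, epochProb th b R d e w) ^ (s + 1) /
        (∏ e : Fin c, epochProb th b R d' e w) ^ s := fun w =>
      div_nonneg (pow_nonneg (Finset.prod_nonneg fun e _ => hnn _ _ _) _)
        (pow_nonneg (Finset.prod_nonneg fun e _ => hnn _ _ _) _)
    refine (Finset.sum_le_sum fun w _ => hterm w).trans ?_
    -- The intercept of the chord may be negative, so nonnegativity of the added terms is read off
    -- from the powers that they dominate.
    refine (Finset.sum_le_sum_of_subset_of_nonneg
      (Finset.filter_subset_filter _ hFsub) fun w _ _ => (hterm0 w).trans (hterm w)).trans ?_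
    rw [sum_prod_mix_eq]
    rcases Nat.eq_zero_or_pos c with h0 | h0
    · simp [h0]
    · have hone := chord_at_one_le (hη h0).1 s
      have hp : 0 ≤ chordIntercept η s + chordSlope η s := by
        have := pow_le_chord (hη h0).1 s (r := 1) (Real.exp_le_one_iff.2 (by linarith [(hη h0).1]))
          (Real.one_le_exp (hη h0).1.le)
        simp only [one_pow, mul_one] at this
        linarith
      gcongr
  have hreal : (noiseMeasure c R).real {ω | history th b d ω N ∈ F} ≤
      Real.exp ε * (noiseMeasure c R).real {ω | history th b d' ω N ∈ F} + δ := by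
    rw [hsum, hsum]
    calc ∑ w ∈ F with Feasible c R w, ∏ e : Fin c, epochProb th b R d e w
        ≤ ∑ w ∈ F with Feasible c R w, (Real.exp ε * (∏ e : Fin c, epochProb th b R d' e w) +
          Real.exp (-(s * ε)) * ((∏ e : Fin c, epochProb th b R d e w) ^ (s + 1) /
            (∏ e : Fin c, epochProb th b R d' e w) ^ s)) := by
          refine Finset.sum_le_sum fun w _ => ?_
          refine le_exp_mul_add_pow_div_pow s (Finset.prod_nonneg fun e _ => hnn _ _ _)
            (Finset.prod_nonneg fun e _ => hnn _ _ _) fun h0 => ?_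
          obtain ⟨e, he, h0⟩ := Finset.prod_eq_zero_iff.1 h0
          refine Finset.prod_eq_zero he (le_antisymm ?_ (hnn _ _ _))
          have := hle d d' hd e w
          rwa [h0, mul_zero] at this
      _ ≤ _ := by
          rw [Finset.sum_add_distrib, ← Finset.mul_sum, ← Finset.mul_sum]
          gcongr
          exact (mul_le_mul_of_nonneg_left hmoment (Real.exp_pos _).le).trans hs
  rw [hset d, hset d', ← ofReal_measureReal (μ := noiseMeasure c R),
    ← ofReal_measureReal (μ := noiseMeasure c R) (s := {ω | history th b d' ω N ∈ F}),
    ← ENNReal.ofReal_mul (Real.exp_pos _).le, ← ENNReal.ofReal_add (by positivity) hδ.1.le]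
  exact ENNReal.ofReal_le_ofReal hreal

end Histories

end LargeGame

/-! ### Medians -/

namespace LargeGame

open History

/-- `x` is a median of `S` for the order relation `P`. -/
def IsMedianPoint {D : Type*} (S : Set D) (P : Set (D × D)) (x : D) : Prop :=
  x ∈ S ∧ 2 * {y ∈ S | (y, x) ∉ P}.ncard ≤ S.ncard ∧ 2 * {y ∈ S | (x, y) ∉ P}.ncard ≤ S.ncard

open Classical in
/-- A median of the values of `q` on `S`; it is `0` if `S` is empty. -/
noncomputable def median {D : Type*} (S : Set D) (q : D → ℝ) : ℝ :=
  (if h : ∃ x, IsMedianPoint S {p | q p.1 ≤ q p.2} x then some h.choose else none).elim 0 q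

/-- Take the smallest value with at most half of `S` strictly above it. If more than half lay
strictly below, the next smaller value would also have at most half above it. -/
theorem exists_isMedianPoint {D : Type*} [Finite D] {S : Set D} (hS : S.Nonempty) (q : D → ℝ) :
    ∃ x, IsMedianPoint S {p | q p.1 ≤ q p.2} x := by
  have hfin : ∀ A : Set D, A.Finite := fun A => A.toFinite
  obtain ⟨z, hzS, hz⟩ := Set.exists_max_image S q (hfin S) hS
  have hne : {x ∈ S | 2 * {y ∈ S | q x < q y}.ncard ≤ S.ncard}.Nonempty := by
    refine ⟨z, hzS, ?_⟩
    have : {y ∈ S | q z < q y} = ∅ := by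
      ext y; simpa using hz y
    rw [this]; simp
  obtain ⟨x, ⟨hxS, hx⟩, hmin⟩ := Set.exists_min_image _ q (hfin _) hne
  refine ⟨x, hxS, by simpa using hx, ?_⟩
  simp only [Set.mem_ofPred_eq, not_le]
  rcases Set.eq_empty_or_nonempty {y ∈ S | q y < q x} with h0 | h0
  · rw [h0]; simp
  · obtain ⟨x', ⟨hx'S, hx'⟩, hmax⟩ := Set.exists_max_image _ q (hfin _) h0
    by_contra! hcon
    have hsub : {y ∈ S | q x' < q y} ∪ {y ∈ S | q y < q x} ⊆ S := by
      rintro y (hy | hy) <;> exact hy.1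
    have hdisj : Disjoint {y ∈ S | q x' < q y} {y ∈ S | q y < q x} := by
      rw [Set.disjoint_left]
      rintro y hy hy'
      exact absurd (hmax y hy') (not_le.2 hy.2)
    have hcard := Set.ncard_le_ncard hsub (hfin S)
    rw [Set.ncard_union_eq hdisj (hfin _) (hfin _)] at hcard
    have := hmin x' ⟨hx'S, by omega⟩
    linarith

theorem median_spec {D : Type*} [Finite D] {S : Set D} (hS : S.Nonempty) (q : D → ℝ) :
    (∃ x ∈ S, median S q = q x) ∧ 2 * {y ∈ S | median S q < q y}.ncard ≤ S.ncard ∧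
      2 * {y ∈ S | q y < median S q}.ncard ≤ S.ncard := by
  have h := exists_isMedianPoint hS q
  have hm : median S q = q h.choose := by
    unfold median; rw [dif_pos h]; rfl
  obtain ⟨h1, h2, h3⟩ := h.choose_spec
  rw [hm]
  exact ⟨⟨_, h1, rfl⟩, by simpa using h2, by simpa using h3⟩

/-- The chosen point depends on `q` only through the order pattern of its values. There are finitely
many pairs of a set and a pattern, and for each of them the median is a coordinate of `q` or 0. -/
theorem measurable_median {D X : Type*} [Finite D] [MeasurableSpace X] {S : X → Set D}
    (hS : Measurable S) {q : X → D → ℝ} (hq : Measurable q) :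
    Measurable fun x => median (S x) (q x) := by
  classical
  have hpat : Measurable fun x => ({p | q x p.1 ≤ q x p.2} : Set (D × D)) := by
    rw [measurable_set_iff]
    intro p
    exact measurableSet_setOfPred.1 (measurableSet_le ((measurable_pi_apply p.1).comp hq)
      ((measurable_pi_apply p.2).comp hq))
  have hsel : Measurable fun z : (D → ℝ) × (Set D × Set (D × D)) =>
      (if h : ∃ x, IsMedianPoint z.2.1 z.2.2 x then some h.choose else none).elim 0 z.1 := by
    have helim : ∀ o : Option D, Measurable fun q : D → ℝ => o.elim 0 q := fun o => by
      cases o with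
      | none => exact measurable_const
      | some x => exact measurable_pi_apply x
    exact measurable_from_prod_countable_left fun SP =>
      helim (if h : ∃ x, IsMedianPoint SP.1 SP.2 x then some h.choose else none)
  exact hsel.comp (hq.prodMk (hS.prodMk hpat))

/-! ### Replaying a history -/

variable {𝒯 : Type*} {n : ℕ}

/-- The set of the tuples of types that are consistent with the outcomes `h` of the tests, and the
answers given so far, when the queries are asked by `B`. -/
noncomputable def replay (B : Querier 𝒯 n) : History → Set (Fin n → 𝒯) × (ℕ → ℝ)
  | [] => (Set.univ, 0)
  | o :: h =>
    let Q := B (rounds h) fun s => (replay B h).2 s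
    let m := median (replay B h).1 Q
    match o with
    | none => ((replay B h).1, Function.update (replay B h).2 (rounds h) m)
    | some true => ({x ∈ (replay B h).1 | m < Q x}, (replay B h).2)
    | some false => ({x ∈ (replay B h).1 | Q x < m}, (replay B h).2)

/-- The query about which the test after the history `h` is made. -/
noncomputable def currentQuery (B : Querier 𝒯 n) (h : History) : Query 𝒯 n :=
  B (rounds h) fun s => (replay B h).2 s

/-- The median of the current query over the tuples of types that are still consistent. -/
noncomputable def currentMedian (B : Querier 𝒯 n) (h : History) : ℝ :=
  median (replay B h).1 (currentQuery B h)

/-- The difference of the true answer to the current query and its median. -/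
noncomputable def gap (B : Querier 𝒯 n) (τ : Fin n → 𝒯) (h : History) : ℝ :=
  currentQuery B h τ - currentMedian B h

theorem replay_none (B : Querier 𝒯 n) (h : History) : replay B (none :: h) =
    ((replay B h).1, Function.update (replay B h).2 (rounds h) (currentMedian B h)) := rfl

theorem replay_true (B : Querier 𝒯 n) (h : History) : replay B (some true :: h) =
    ({x ∈ (replay B h).1 | currentMedian B h < currentQuery B h x}, (replay B h).2) := rfl

theorem replay_false (B : Querier 𝒯 n) (h : History) : replay B (some false :: h) =
    ({x ∈ (replay B h).1 | currentQuery B h x < currentMedian B h}, (replay B h).2) := rfl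

theorem replay_cons_ans (B : Querier 𝒯 n) (o : Option Bool) (h : History) {s : ℕ}
    (hs : s < rounds h) : (replay B (o :: h)).2 s = (replay B h).2 s := by
  rcases o with _ | _ | _
  · rw [replay_none]; exact Function.update_of_ne hs.ne _ _
  · rfl
  · rfl

/-- The median is determined by the history alone, so only the true answer changes between
neighbouring databases. -/
theorem abs_gap_sub_gap_le {B : Querier 𝒯 n} {lam : ℝ} (hB : B.IsAdmissible lam)
    (τ : Fin n → 𝒯) (i : Fin n) (θ : 𝒯) (h : History) :
    |gap B τ h - gap B (Function.update τ i θ) h| ≤ lam := by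
  unfold gap
  rw [sub_sub_sub_cancel_right]
  exact hB.2 _ _ τ i θ

/-- The querier that asks the given queries whatever the answers. -/
def Querier.ofStream (q : ℕ → Query 𝒯 n) : Querier 𝒯 n := fun r _ => q r

theorem measurable_replay_ofStream [Finite 𝒯] {X : Type*} [MeasurableSpace X]
    {q : X → ℕ → Query 𝒯 n} (hq : ∀ r, Measurable fun x => q x r) (h : History) :
    (Measurable fun x => (replay (.ofStream (q x)) h).1) ∧
      ∀ s, Measurable fun x => (replay (.ofStream (q x)) h).2 s := by
  induction h with
  | nil => exact ⟨measurable_const, fun s => measurable_const⟩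
  | cons o h ih =>
    have hm : Measurable fun x => currentMedian (.ofStream (q x)) h :=
      measurable_median ih.1 (hq _)
    have hQ : ∀ y, Measurable fun x => currentQuery (.ofStream (q x)) h y := fun y =>
      (measurable_pi_apply y).comp (hq _)
    rcases o with _ | _ | _
    · refine ⟨ih.1, fun s => ?_⟩
      simp only [replay_none, Function.update_apply]
      split_ifs
      · exact hm
      · exact ih.2 s
    · refine ⟨?_, ih.2⟩
      simp only [replay_false]
      rw [measurable_set_iff]
      exact fun y => ((measurable_set_iff.1 ih.1) y).and
        (measurableSet_setOfPred.1 (measurableSet_lt (hQ y) hm))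
    · refine ⟨?_, ih.2⟩
      simp only [replay_true]
      rw [measurable_set_iff]
      exact fun y => ((measurable_set_iff.1 ih.1) y).and
        (measurableSet_setOfPred.1 (measurableSet_lt hm (hQ y)))

/-! ### The mechanism facing an adaptive querier -/

section Interaction

variable {c R : ℕ} (th b : ℝ)

/-- There are countably many histories, so it suffices to treat each fixed history. -/
theorem measurable_replay_history_ofStream [Finite 𝒯] {X : Type*} [MeasurableSpace X]
    {q : X → ℕ → Query 𝒯 n} (hq : ∀ r, Measurable fun x => q x r) (τ : Fin n → 𝒯) (N s : ℕ) :
    Measurable fun p : Noise c R × X => (replay (.ofStream (q p.2))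
      (history th b (gap (.ofStream (q p.2)) τ) p.1 N)).2 s := by
  let _ : MeasurableSpace History := ⊤
  let _ : MeasurableSpace (Option Bool) := ⊤
  have hq' : ∀ r, Measurable fun p : Noise c R × X => q p.2 r := fun r => (hq r).comp measurable_snd
  have hgap : ∀ h, Measurable fun p : Noise c R × X => gap (.ofStream (q p.2)) τ h := fun h =>
    ((measurable_pi_apply τ).comp (hq' (rounds h))).sub
      (measurable_median (measurable_replay_ofStream hq' h).1 (hq' _))
  have hnext : ∀ h, Measurable fun p : Noise c R × X =>
      nextOutcome th b (gap (.ofStream (q p.2)) τ) p.1 h := by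
    intro h
    unfold nextOutcome
    split_ifs with H
    · exact measurable_testOutcome th b ⟨rounds h, H.2⟩
        (x := fun p : Noise c R × X => p.1 ⟨epoch h, H.1⟩)
        ((measurable_pi_apply _).comp measurable_fst) (hgap h)
    · exact measurable_const
  have hhist : ∀ j, Measurable fun p : Noise c R × X =>
      history th b (gap (.ofStream (q p.2)) τ) p.1 j := by
    intro j
    induction j with
    | zero => exact measurable_const
    | succ j ih =>
      have hG : Measurable fun z : (Noise c R × X) × History =>
          nextOutcome th b (gap (.ofStream (q z.1.2)) τ) z.1.1 z.2 :: z.2 := by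
        refine measurable_from_prod_countable_left fun h => ?_
        exact (measurable_from_top (f := fun o : Option Bool => o :: h)).comp
          (hnext h)
      exact hG.comp (measurable_id.prodMk ih)
  have hF : Measurable fun z : (Noise c R × X) × History =>
      (replay (.ofStream (q z.1.2)) z.2).2 s :=
    measurable_from_prod_countable_left fun h => (measurable_replay_ofStream hq' h).2 s
  exact hF.comp (measurable_id.prodMk (hhist N))

theorem rounds_history_mono (d : History → ℝ) (ω : Noise c R) :
    Monotone fun j => rounds (history th b d ω j) :=
  monotone_nat_of_le_succ fun _ => rounds_le_cons _ _

theorem replay_history_ans (B : Querier 𝒯 n) (d : History → ℝ) (ω : Noise c R) {j N s : ℕ}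
    (hj : j ≤ N) (hs : s < rounds (history th b d ω j)) :
    (replay B (history th b d ω N)).2 s = (replay B (history th b d ω j)).2 s := by
  induction N, hj using Nat.le_induction with
  | base => rfl
  | succ N hN ih =>
    rw [← ih]
    exact replay_cons_ans B _ _ (hs.trans_le (rounds_history_mono th b d ω hN))

/-- The answers of the first `r + 1` rounds only depend on the queries asked in these rounds. -/
theorem replay_history_congr (B B' : Querier 𝒯 n) (τ : Fin n → 𝒯) (ω : Noise c R) (N r : ℕ)
    (H : ∀ j ≤ N, rounds (history th b (gap B τ) ω j) ≤ r →
      currentQuery B (history th b (gap B τ) ω j) =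
        B' (rounds (history th b (gap B τ) ω j))
          fun s => (replay B (history th b (gap B τ) ω j)).2 s) {s : ℕ} (hs : s ≤ r) :
    (replay B (history th b (gap B τ) ω N)).2 s =
      (replay B' (history th b (gap B' τ) ω N)).2 s := by
  -- Either the two runs still coincide, or both have passed round `r` and their answers up to `r`
  -- are equal and final.
  have key : ∀ j ≤ N, (history th b (gap B τ) ω j = history th b (gap B' τ) ω j ∧
      replay B (history th b (gap B τ) ω j) = replay B' (history th b (gap B' τ) ω j)) ∨
      (r < rounds (history th b (gap B τ) ω j) ∧ r < rounds (history th b (gap B' τ) ω j) ∧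
        ∀ s ≤ r, (replay B (history th b (gap B τ) ω j)).2 s =
          (replay B' (history th b (gap B' τ) ω j)).2 s) := by
    intro j
    induction j with
    | zero => exact fun _ => Or.inl ⟨rfl, rfl⟩
    | succ j ih =>
      intro hj
      have hfar : (r < rounds (history th b (gap B τ) ω j) ∧
          r < rounds (history th b (gap B' τ) ω j) ∧
          ∀ s ≤ r, (replay B (history th b (gap B τ) ω j)).2 s =
            (replay B' (history th b (gap B' τ) ω j)).2 s) →
          (r < rounds (history th b (gap B τ) ω (j + 1)) ∧
          r < rounds (history th b (gap B' τ) ω (j + 1)) ∧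
          ∀ s ≤ r, (replay B (history th b (gap B τ) ω (j + 1))).2 s =
            (replay B' (history th b (gap B' τ) ω (j + 1))).2 s) := by
        rintro ⟨h1, h2, h3⟩
        refine ⟨h1.trans_le (rounds_le_cons _ _), h2.trans_le (rounds_le_cons _ _),
          fun s hs => ?_⟩
        exact (replay_cons_ans B _ _ (hs.trans_lt h1)).trans
          ((h3 s hs).trans (replay_cons_ans B' _ _ (hs.trans_lt h2)).symm)
      rcases ih (by omega) with ⟨h1, h2⟩ | h
      · by_cases hr : rounds (history th b (gap B τ) ω j) ≤ r
        · left
          have hQ := H j (by omega) hr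
          simp only [history]
          rw [← h1] at h2 ⊢
          set h := history th b (gap B τ) ω j
          have hQ' : currentQuery B h = currentQuery B' h := by
            rw [hQ, currentQuery, h2]
          have hm : currentMedian B h = currentMedian B' h := by
            rw [currentMedian, currentMedian, hQ', h2]
          have hn : nextOutcome th b (gap B τ) ω h = nextOutcome th b (gap B' τ) ω h := by
            unfold nextOutcome gap
            rw [hQ', hm]
          refine ⟨by rw [hn], ?_⟩
          rw [hn]
          rcases nextOutcome th b (gap B' τ) ω h with _ | _ | _
          · rw [replay_none, replay_none, h2, hm]
          · rw [replay_false, replay_false, h2, hm, hQ']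
          · rw [replay_true, replay_true, h2, hm, hQ']
        · right
          refine hfar ⟨not_le.1 hr, h1 ▸ not_le.1 hr, fun s _ => by rw [h2]⟩
      · exact Or.inr (hfar h)
  rcases key N le_rfl with ⟨-, h⟩ | ⟨-, -, h⟩
  · rw [h]
  · exact h s hs

variable (𝒯 n c R) in
/-- The Median Mechanism with threshold `th` and noise of scale `b`, which makes at most `c`
updates. -/
noncomputable abbrev medianMechanism [Finite 𝒯] : QueryMechanism 𝒯 n where
  Ω := Noise c R
  μ := noiseMeasure c R
  answer r ω τ q :=
    (replay (.ofStream fun s => if h : s < r + 1 then q ⟨s, h⟩ else 0)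
      (history th b (gap (.ofStream fun s => if h : s < r + 1 then q ⟨s, h⟩ else 0) τ) ω
        (R + c))).2 r
  measurable_answer r τ := by
    refine measurable_replay_history_ofStream (X := Fin (r + 1) → Query 𝒯 n)
      (q := fun q s => if h : s < r + 1 then q ⟨s, h⟩ else 0) th b (fun s => ?_) τ (R + c) r
    by_cases h : s < r + 1
    · simp only [h, dif_pos]; exact measurable_pi_apply _
    · simp only [h, dif_neg, not_false_eq_true]; exact measurable_const

theorem QueryMechanism.answers_succ (M : QueryMechanism 𝒯 n) (B : Querier 𝒯 n)
    (τ : Fin n → 𝒯) (ω : M.Ω) (r : ℕ) :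
    M.answers B τ ω (r + 1) = Fin.snoc (α := fun _ => ℝ) (M.answers B τ ω r)
      (M.answer r ω τ fun s => B s fun m =>
        M.answers B τ ω r ⟨m, lt_of_lt_of_le m.isLt (Nat.lt_succ_iff.mp s.isLt)⟩) := rfl

/-- In every round the mechanism recomputes the interaction from the start, with the same noise and
with 0 in place of the queries still unknown. These placeholders influence only later rounds, so all
answers agree with one single run against `B`. -/
theorem medianMechanism_answers [Finite 𝒯] (B : Querier 𝒯 n) (τ : Fin n → 𝒯) (ω : Noise c R)
    (r : ℕ) : (medianMechanism 𝒯 n c R th b).answers B τ ω r =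
      fun s : Fin r => (replay B (history th b (gap B τ) ω (R + c))).2 s := by
  induction r with
  | zero => exact funext fun s => s.elim0
  | succ r ih =>
    funext s
    refine Fin.lastCases ?_ (fun s => ?_) s
    · rw [QueryMechanism.answers_succ, Fin.snoc_last]
      symm
      refine replay_history_congr th b B _ τ ω (R + c) r (fun j hj hjr => ?_) le_rfl
      simp only [Querier.ofStream, Nat.lt_succ_iff.2 hjr, dif_pos, ih]
      unfold currentQuery
      congr 1
      funext s
      exact (replay_history_ans th b B (gap B τ) ω hj s.2).symm
    · rw [QueryMechanism.answers_succ, Fin.snoc_castSucc, ih]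
      rfl

end Interaction

end LargeGame

/-! ### Accuracy and privacy of the Median Mechanism -/

namespace LargeGame

open History

variable {𝒯 : Type*} {n : ℕ}

/-- The noises are nonnegative, those of the thresholds are at most `U`, and the others are less
than `U'`. -/
def GoodNoise {c R : ℕ} (U U' : ℝ) (ω : Noise c R) : Prop :=
  ∀ e, (∀ i, 0 ≤ ω e i) ∧ ω e none ≤ U ∧ ∀ j, ω e (some j) < U'

/-- With threshold `b * U'` and test noises in `[0, U')`, a successful test proves the sign of the
gap, so `τ` stays in the retained set, whose size is at most halved. A failed test proves that the
gap is below `b * (U + U')`, because its noise is nonnegative. -/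
theorem replay_history_invariant [Finite 𝒯] {c R : ℕ} {b U U' : ℝ} (hb : 0 < c → 0 < b)
    (hbU : 0 ≤ b * (U + U')) (hc : Nat.card (Fin n → 𝒯) < 2 ^ (c + 1)) (B : Querier 𝒯 n)
    (τ : Fin n → 𝒯) {ω : Noise c R} (hω : GoodNoise U U' ω) (j : ℕ) :
    ∀ h, h = history (b * U') b (gap B τ) ω j →
      τ ∈ (replay B h).1 ∧ (replay B h).1.ncard * 2 ^ epoch h ≤ Nat.card (Fin n → 𝒯) ∧
      epoch h ≤ c ∧ ∀ s < rounds h, s < R →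
        |(replay B h).2 s - B s (fun m => (replay B h).2 m) τ| ≤ b * (U + U') := by
  induction j with
  | zero =>
    rintro _ rfl
    refine ⟨Set.mem_univ _, ?_, by simp [history], by simp [history]⟩
    simp [history, replay, Set.ncard_univ]
  | succ j ih =>
    obtain ⟨h1, h2, h3, h4⟩ := ih _ rfl
    simp only [history]
    set h := history (b * U') b (gap B τ) ω j
    have hne : (replay B h).1.Nonempty := ⟨τ, h1⟩
    obtain ⟨⟨x, hxS, hx⟩, hup, hdown⟩ := median_spec hne (currentQuery B h)
    -- the last outcome completes a round
    have hnone : (rounds h < R → |gap B τ h| ≤ b * (U + U')) → ∀ s < rounds (none :: h), s < R →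
        |(replay B (none :: h)).2 s - B s (fun m => (replay B (none :: h)).2 m) τ|
          ≤ b * (U + U') := by
      intro hgap s hs hsR
      have hupd : ∀ m < rounds h, (replay B (none :: h)).2 m = (replay B h).2 m :=
        fun m hm => replay_cons_ans B none h hm
      have hs' : s ≤ rounds h := by simpa [Nat.lt_succ_iff] using hs
      have hfun : (fun m : Fin s => (replay B (none :: h)).2 m) =
          fun m : Fin s => (replay B h).2 m :=
        funext fun m => hupd m (m.2.trans_le hs')
      rw [hfun]
      rcases hs'.lt_or_eq with hlt | rfl
      · rw [hupd s hlt]; exact h4 s hlt hsR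
      · have : (replay B (none :: h)).2 (rounds h) = currentMedian B h := by
          rw [replay_none]; exact Function.update_self _ _ _
        rw [this, abs_sub_comm]
        exact hgap hsR
    rintro _ rfl
    by_cases H : epoch h < c ∧ rounds h < R
    · have hb0 : 0 < b := hb (by omega)
      have hn : nextOutcome (b * U') b (gap B τ) ω h =
          testOutcome (b * U') b (ω ⟨epoch h, H.1⟩) ⟨rounds h, H.2⟩ (gap B τ h) := by
        unfold nextOutcome; rw [dif_pos H]
      rw [hn]
      obtain ⟨hω0, hωU, hωU'⟩ := hω ⟨epoch h, H.1⟩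
      set z := ω ⟨epoch h, H.1⟩
      have hz0 : 0 ≤ b * z none := mul_nonneg hb0.le (hω0 _)
      have hzU : b * z none ≤ b * U := by gcongr
      have hzj : ∀ i, 0 ≤ b * z (some i) := fun i => mul_nonneg hb0.le (hω0 _)
      have hzU' : ∀ i, b * z (some i) < b * U' := fun i => mul_lt_mul_of_pos_left (hωU' i) hb0
      have hgap : gap B τ h = currentQuery B h τ - currentMedian B h := rfl
      have hcard : ∀ A : Set (Fin n → 𝒯), 2 * A.ncard ≤ (replay B h).1.ncard →
          A.ncard * 2 ^ (epoch h + 1) ≤ Nat.card (Fin n → 𝒯) := by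
        intro A hA
        refine le_trans ?_ h2
        rw [pow_succ, ← mul_assoc, mul_right_comm, mul_comm _ 2]
        gcongr
      rcases ho : testOutcome (b * U') b z ⟨rounds h, H.2⟩ (gap B τ h) with _ | _ | _
      · rw [testOutcome_eq_none] at ho
        refine ⟨h1, by simpa [replay_none] using h2, by simpa using h3, hnone fun _ => ?_⟩
        rw [abs_le]
        have e1 := hzj (⟨rounds h, H.2⟩, true)
        have e2 := hzj (⟨rounds h, H.2⟩, false)
        constructor <;> linarith [ho.1, ho.2]
      · rw [testOutcome_eq_false] at ho
        refine ⟨⟨h1, ?_⟩, ?_, by simp; omega, ?_⟩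
        · have := hzU' (⟨rounds h, H.2⟩, false)
          show currentQuery B h τ < currentMedian B h
          linarith [ho.2]
        · rw [epoch_some]; exact hcard _ hdown
        · simpa [replay_false] using h4
      · rw [testOutcome_eq_true] at ho
        refine ⟨⟨h1, ?_⟩, ?_, by simp; omega, ?_⟩
        · have := hzU' (⟨rounds h, H.2⟩, true)
          show currentMedian B h < currentQuery B h τ
          linarith
        · rw [epoch_some]; exact hcard _ hup
        · simpa [replay_true] using h4
    · have hn : nextOutcome (b * U') b (gap B τ) ω h = none := by
        unfold nextOutcome; rw [dif_neg H]
      rw [hn]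
      refine ⟨h1, by simpa [replay_none] using h2, by simpa using h3, hnone fun hR => ?_⟩
      -- No test is made after `c` epochs. By then fewer than two tuples remain, so the set is `{τ}`
      -- and the median is exact.
      have he : epoch h = c := le_antisymm h3 (by by_contra hlt; exact H ⟨by omega, hR⟩)
      have hone : (replay B h).1.ncard ≤ 1 := by
        rw [he] at h2
        by_contra hcon
        have : 2 * 2 ^ c ≤ (replay B h).1.ncard * 2 ^ c := Nat.mul_le_mul_right _ (by omega)
        rw [pow_succ] at hc
        omega
      have hxτ : x = τ := Set.ncard_le_one (Set.toFinite _) |>.1 hone x hxS τ h1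
      have : gap B τ h = 0 := by
        rw [gap, currentMedian, hx, hxτ, sub_self]
      rw [this, abs_zero]
      exact hbU

theorem medianMechanism_accurate_of_goodNoise [Finite 𝒯] {c R : ℕ} {b U U' : ℝ}
    (hb : 0 < c → 0 < b) (hbU : 0 ≤ b * (U + U')) (hc : Nat.card (Fin n → 𝒯) < 2 ^ (c + 1))
    (B : Querier 𝒯 n) (τ : Fin n → 𝒯) {ω : Noise c R} (hω : GoodNoise U U' ω) (r : Fin R) :
    |(medianMechanism 𝒯 n c R (b * U') b).answers B τ ω R r - B r (fun m =>
        (medianMechanism 𝒯 n c R (b * U') b).answers B τ ω R ⟨m, m.isLt.trans r.isLt⟩) τ|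
      ≤ b * (U + U') := by
  rw [medianMechanism_answers]
  obtain ⟨-, -, h3, h4⟩ := replay_history_invariant hb hbU hc B τ hω (R + c) _ rfl
  refine h4 r ?_ r.2
  have h5 := epoch_add_rounds (history (b * U') b (gap B τ) ω (R + c))
  rw [history_length] at h5
  have := r.2
  omega

theorem noiseMeasure_eval {c R : ℕ} (e : Fin c) (i : Option (Fin R × Bool)) {s : Set ℝ}
    (hs : MeasurableSet s) : noiseMeasure c R {ω | ω e i ∈ s} = unitExp s := by
  have h1 : MeasurePreserving (fun ω : Noise c R => ω e) (noiseMeasure c R) (epochNoiseMeasure R) :=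
    measurePreserving_eval (fun _ : Fin c => epochNoiseMeasure R) e
  have h2 : MeasurePreserving (fun x : EpochNoise R => x i) (epochNoiseMeasure R) unitExp :=
    measurePreserving_eval (fun _ : Option (Fin R × Bool) => unitExp) i
  exact (h2.comp h1).measure_preimage hs.nullMeasurableSet

theorem noiseMeasure_not_goodNoise_le {c R : ℕ} {U U' : ℝ} (hU : 0 < c → 0 ≤ U)
    (hU' : 0 < c → 0 ≤ U') :
    noiseMeasure c R {ω | ¬ GoodNoise U U' ω} ≤
      ENNReal.ofReal (c * (Real.exp (-U) + 2 * R * Real.exp (-U'))) := by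
  have hsub : {ω : Noise c R | ¬ GoodNoise U U' ω} ⊆ ⋃ e : Fin c,
      ((⋃ i, {ω : Noise c R | ω e i ∈ Set.Iio 0}) ∪ ({ω | ω e none ∈ Set.Ici U} ∪
        ⋃ j, {ω | ω e (some j) ∈ Set.Ici U'})) := by
    intro ω hω
    simp only [GoodNoise, Set.mem_ofPred_eq, not_forall, not_and_or, not_le, not_lt] at hω
    obtain ⟨e, ⟨i, h⟩ | h | ⟨j, h⟩⟩ := hω
    · exact Set.mem_iUnion.2 ⟨e, Or.inl (Set.mem_iUnion.2 ⟨i, h⟩)⟩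
    · exact Set.mem_iUnion.2 ⟨e, Or.inr (Or.inl h.le)⟩
    · exact Set.mem_iUnion.2 ⟨e, Or.inr (Or.inr (Set.mem_iUnion.2 ⟨j, h⟩))⟩
  have hepoch : ∀ e : Fin c, noiseMeasure c R ((⋃ i, {ω : Noise c R | ω e i ∈ Set.Iio 0}) ∪
      ({ω | ω e none ∈ Set.Ici U} ∪ ⋃ j, {ω | ω e (some j) ∈ Set.Ici U'})) ≤
      ENNReal.ofReal (Real.exp (-U) + 2 * R * Real.exp (-U')) := by
    intro e
    have h0 : noiseMeasure c R (⋃ i, {ω : Noise c R | ω e i ∈ Set.Iio 0}) = 0 :=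
      measure_iUnion_null fun i => by
        rw [noiseMeasure_eval e i measurableSet_Iio, unitExp_Iio_zero]
    have h1 : noiseMeasure c R {ω | ω e none ∈ Set.Ici U} ≤ ENNReal.ofReal (Real.exp (-U)) := by
      rw [noiseMeasure_eval e none measurableSet_Ici]
      exact unitExp_Ici_le (hU (Fin.pos e))
    have h2 : noiseMeasure c R (⋃ j, {ω | ω e (some j) ∈ Set.Ici U'}) ≤
        ENNReal.ofReal (2 * R * Real.exp (-U')) := by
      calc _ ≤ ∑ j : Fin R × Bool, noiseMeasure c R {ω | ω e (some j) ∈ Set.Ici U'} := by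
            rw [← tsum_fintype (L := .unconditional _)]
            exact measure_iUnion_le _
        _ ≤ ∑ j : Fin R × Bool, ENNReal.ofReal (Real.exp (-U')) := by
            refine Finset.sum_le_sum fun j _ => ?_
            rw [noiseMeasure_eval e (some j) measurableSet_Ici]
            exact unitExp_Ici_le (hU' (Fin.pos e))
        _ = _ := by
            rw [← ENNReal.ofReal_sum_of_nonneg fun j _ => (Real.exp_pos _).le]
            congr 1
            simp
            ring
    refine (measure_union_le _ _).trans ?_
    rw [h0, zero_add]
    refine (measure_union_le _ _).trans ((add_le_add h1 h2).trans ?_)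
    rw [ENNReal.ofReal_add (Real.exp_pos _).le (by positivity)]
  calc _ ≤ ∑ e : Fin c, noiseMeasure c R _ := by
        refine (measure_mono hsub).trans ?_
        rw [← tsum_fintype (L := .unconditional _)]
        exact measure_iUnion_le _
    _ ≤ ∑ e : Fin c, ENNReal.ofReal (Real.exp (-U) + 2 * R * Real.exp (-U')) :=
        Finset.sum_le_sum fun e _ => hepoch e
    _ = _ := by
        rw [← ENNReal.ofReal_sum_of_nonneg fun j _ => by positivity]
        simp only [Finset.sum_const, Finset.card_univ, Fintype.card_fin, nsmul_eq_mul]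

/-- The answers are a function of the history, so this is postprocessing of `history_private`. -/
theorem medianMechanism_private [Finite 𝒯] {c R : ℕ} {th b lam η ε δ : ℝ}
    (hη : 0 < c → 0 < η ∧ b * η = 3 * lam) (hε : ε ∈ Set.Ioc (0 : ℝ) 1)
    (hδ : δ ∈ Set.Ioc (0 : ℝ) 1) (hc : c * η ^ 2 ≤ ε ^ 2 / (2 * Real.log (4 / δ))) :
    (medianMechanism 𝒯 n c R th b).IsPrivate ε δ lam R := by
  intro B hB τ i θ E _
  simp only [medianMechanism_answers]
  exact history_private hη hε hδ hc (abs_gap_sub_gap_le hB τ i θ) (R + c)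
    {h | (fun s : Fin R => (replay B h).2 s) ∈ E}

theorem exists_isMedianMechanism (𝒯 : Type*) [Fintype 𝒯] [Nonempty 𝒯] {n R : ℕ} {ε δ lam β : ℝ} (hn : 0 < n)
    (hε : ε ∈ Set.Ioc (0 : ℝ) 1) (hδ : δ ∈ Set.Ioc (0 : ℝ) 1) (hlam : 0 < lam)
    (hβ : β ∈ Set.Ioc (0 : ℝ) 1) (hR : n * Fintype.card 𝒯 ≤ R) :
    ∃ M : QueryMechanism 𝒯 n, M.IsMedianMechanism ε δ lam β R := by
  set D := Nat.card (Fin n → 𝒯) with hD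
  have hDcard : D = Fintype.card 𝒯 ^ n := by simp [hD, Nat.card_eq_fintype_card]
  have hm : 0 < Fintype.card 𝒯 := Fintype.card_pos
  have hD0 : D ≠ 0 := by rw [hDcard]; positivity
  set c := Nat.log 2 D with hcdef
  set L := Real.log (4 / δ) with hL
  have hL2 := log_four_div_ge hδ
  have hlog2 := Real.log_two_gt_d9
  have hL0 : 0 < L := by rw [hL]; linarith
  have hcR : c ≤ R := by
    refine le_trans ?_ hR
    refine (Nat.log_lt_of_lt_pow hD0 ?_).le
    rw [hDcard, mul_comm n, pow_mul]
    exact Nat.pow_lt_pow_left Nat.lt_two_pow_self hn.ne'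
  have hclog : c * Real.log 2 ≤ n * Real.log (Fintype.card 𝒯) := by
    rw [← Real.log_pow, ← Real.log_pow]
    have : (2 : ℝ) ^ c ≤ (Fintype.card 𝒯 : ℝ) ^ n := by
      have := Nat.pow_log_le_self 2 hD0
      rw [← hcdef, hDcard] at this
      exact_mod_cast this
    exact Real.log_le_log (by positivity) this
  have hε0 := hε.1
  have hβ0 := hβ.1
  -- The values of `U` and `U'` make the threshold noises and the test noises each contribute `β /
  -- 2` to the failure probability.
  set U := Real.log (2 * c / β) with hU
  set U' := Real.log (4 * c * R / β) with hU'
  -- This is `3 * lam / η` for the budget per epoch `η = ε / √(2cL)`, which makes `c * η ^ 2 = ε ^ 2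
  -- / (2 * L)`. With a single type, `c = 0` and `b = 0`.
  set b := 3 * lam * √(2 * c * L) / ε with hb
  have hU0 : 0 < c → 0 ≤ U := fun hc => Real.log_nonneg <| by
    have : (1 : ℝ) ≤ c := by exact_mod_cast hc
    rw [le_div_iff₀ hβ0]; linarith [hβ.2]
  have hU'0 : 0 < c → 0 ≤ U' := fun hc => Real.log_nonneg <| by
    have h1 : (1 : ℝ) ≤ c := by exact_mod_cast hc
    have h2 : (1 : ℝ) ≤ R := by exact_mod_cast hc.trans_le hcR
    rw [le_div_iff₀ hβ0]; nlinarith [hβ.2]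
  have hb0 : 0 < c → 0 < b := fun hc => by
    have h1 : (0 : ℝ) < c := by exact_mod_cast hc
    positivity
  have hbz : c = 0 → b = 0 := fun h => by simp [hb, h]
  have hbU : 0 ≤ b * (U + U') := by
    rcases Nat.eq_zero_or_pos c with h | h
    · simp [hbz h]
    · exact mul_nonneg (hb0 h).le (add_nonneg (hU0 h) (hU'0 h))
  have herr : b * (U + U') ≤ medianError n (Fintype.card 𝒯) R ε δ lam β := by
    have hR1 : (1 : ℝ) ≤ R := by
      exact_mod_cast (Nat.mul_pos hn hm).trans_le hR
    have hm1 : 0 ≤ Real.log (Fintype.card 𝒯) := Real.log_nonneg (by exact_mod_cast hm)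
    have hx0 : 0 ≤ Real.log (2 * R / β) := Real.log_nonneg <| by
      rw [le_div_iff₀ hβ0]; linarith [hβ.2]
    unfold medianError
    rw [← hL]
    rcases Nat.eq_zero_or_pos c with h | h
    · rw [hbz h, zero_mul]; positivity
    have hc1 : (1 : ℝ) ≤ c := by exact_mod_cast h
    have hcR' : (c : ℝ) ≤ R := by exact_mod_cast hcR
    have hUx : U ≤ Real.log (2 * R / β) := Real.log_le_log (by positivity) (by gcongr)
    have hU'x : U' ≤ 2 * Real.log (2 * R / β) := by
      rw [show (2 : ℝ) * Real.log (2 * R / β) = Real.log ((2 * R / β) ^ 2) by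
        rw [Real.log_pow]; norm_num]
      refine Real.log_le_log (by positivity) ?_
      rw [div_pow, mul_pow, show (2 : ℝ) ^ 2 = 4 by norm_num, mul_assoc, sq (R : ℝ)]
      have : β ^ 2 ≤ β := by nlinarith [hβ.2]
      gcongr
    -- Since `2 log 2 ≤ L`, the root of `L` is replaced by a multiple of `L`, as in `medianError`.
    -- The final constant is `9 / log 2 < 16`.
    have hsqrt : √(2 * c * L) ≤ √(n * Real.log (Fintype.card 𝒯)) * (L / Real.log 2) := by
      rw [← Real.sqrt_sq (show 0 ≤ L / Real.log 2 by positivity), ← Real.sqrt_mul (by positivity)]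
      refine Real.sqrt_le_sqrt ?_
      calc 2 * c * L = (c * Real.log 2) * (2 * Real.log 2 * L / Real.log 2 ^ 2) := by
            field_simp
        _ ≤ (n * Real.log (Fintype.card 𝒯)) * (L * L / Real.log 2 ^ 2) := by gcongr
        _ = _ := by rw [div_pow, sq L]
    calc b * (U + U') ≤ b * (3 * Real.log (2 * R / β)) :=
          mul_le_mul_of_nonneg_left (by linarith) (hb0 h).le
      _ ≤ 3 * lam * (√(n * Real.log (Fintype.card 𝒯)) * (L / Real.log 2)) / ε *
          (3 * Real.log (2 * R / β)) := by rw [hb]; gcongr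
      _ = 9 / Real.log 2 *
          (ε⁻¹ * lam * √(n * Real.log (Fintype.card 𝒯)) * Real.log (2 * R / β) * L) := by
          field_simp; ring
      _ ≤ 16 * (ε⁻¹ * lam * √(n * Real.log (Fintype.card 𝒯)) * Real.log (2 * R / β) * L) := by
          gcongr
          rw [div_le_iff₀ (by positivity)]
          linarith
      _ = _ := by ring
  refine ⟨medianMechanism 𝒯 n c R (b * U') b, ?_, ?_⟩
  · refine medianMechanism_private (η := ε / √(2 * c * L)) (fun hc => ?_) hε hδ ?_
    · have h1 : (0 : ℝ) < c := by exact_mod_cast hc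
      have h2 : 0 < √(2 * c * L) := by positivity
      refine ⟨by positivity, ?_⟩
      rw [hb]; field_simp
    · rcases Nat.eq_zero_or_pos c with h | h
      · rw [h]; simp; positivity
      · have h1 : (0 : ℝ) < c := by exact_mod_cast h
        rw [div_pow, Real.sq_sqrt (by positivity)]
        refine le_of_eq ?_
        rw [← hL]
        field_simp
  · intro B _ τ
    refine le_trans (measure_mono (t := {ω : Noise c R | ¬ GoodNoise U U' ω})
      fun ω hω hgood => ?_) ((noiseMeasure_not_goodNoise_le hU0 hU'0).trans (ENNReal.ofReal_le_ofReal ?_))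
    · obtain ⟨r, hr⟩ := hω
      exact absurd (medianMechanism_accurate_of_goodNoise hb0 hbU (Nat.lt_pow_succ_log_self
        one_lt_two D) B τ hgood r) (not_le.2 (herr.trans_lt hr))
    · rcases Nat.eq_zero_or_pos c with h | h
      · rw [h]; simpa using hβ0.le
      · have h1 : (0 : ℝ) < c := by exact_mod_cast h
        have h2 : (0 : ℝ) < R := by exact_mod_cast h.trans_le hcR
        rw [hU, hU', Real.exp_neg, Real.exp_neg, Real.exp_log (by positivity),
          Real.exp_log (by positivity)]
        refine le_of_eq ?_
        field_simp
        norm_num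

end LargeGame

/-! ### A no-swap-regret algorithm

The multiplicative weights algorithm runs with the maps `f : Fin k → Fin k` as experts. The mixed
strategy is an approximate fixed point of the mixture of these maps. -/

namespace LargeGame

section SwapRegret

variable {k : ℕ}

/-- The distribution of `f i` for independent `f` and `i` distributed according to `w` and `p`. -/
def pushMix (w : (Fin k → Fin k) → ℝ) (p : Fin k → ℝ) : Fin k → ℝ :=
  fun j => ∑ f, w f * ∑ i, if f i = j then p i else 0

theorem sum_pushMix_mul (w : (Fin k → Fin k) → ℝ) (p l : Fin k → ℝ) :
    ∑ j, pushMix w p j * l j = ∑ f, w f * ∑ i, p i * l (f i) := by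
  simp only [pushMix, Finset.sum_mul, Finset.mul_sum]
  rw [Finset.sum_comm]
  refine Finset.sum_congr rfl fun f _ => ?_
  rw [Finset.sum_comm]
  refine Finset.sum_congr rfl fun i _ => ?_
  simp [ite_mul, mul_ite, mul_assoc]

theorem pushMix_mem {w : (Fin k → Fin k) → ℝ} (hw : w ∈ stdSimplex ℝ (Fin k → Fin k))
    {p : Fin k → ℝ} (hp : p ∈ stdSimplex ℝ (Fin k)) : pushMix w p ∈ stdSimplex ℝ (Fin k) := by
  refine ⟨fun j => Finset.sum_nonneg fun f _ => mul_nonneg (hw.1 f) (Finset.sum_nonneg fun i _ => ?_),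
    ?_⟩
  · split_ifs
    exacts [hp.1 i, le_rfl]
  · have h := sum_pushMix_mul w p 1
    simpa [hp.2, hw.2] using h

variable (k) in
/-- The uniform mixed strategy. -/
noncomputable def uniformPlay : Fin k → ℝ := fun _ => 1 / k

theorem uniformPlay_mem (hk : 0 < k) : uniformPlay k ∈ stdSimplex ℝ (Fin k) := by
  refine ⟨fun j => by unfold uniformPlay; positivity, ?_⟩
  have : (k : ℝ) ≠ 0 := by exact_mod_cast hk.ne'
  simp [uniformPlay, this]

/-- The average of the first `m` iterates of `pushMix w` at the uniform mixed strategy. -/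
noncomputable def cesaroPlay (w : (Fin k → Fin k) → ℝ) (m : ℕ) : Fin k → ℝ :=
  fun j => (∑ s ∈ Finset.range m, (pushMix w)^[s] (uniformPlay k) j) / m

theorem iterate_pushMix_mem (hk : 0 < k) {w : (Fin k → Fin k) → ℝ}
    (hw : w ∈ stdSimplex ℝ (Fin k → Fin k)) (s : ℕ) :
    (pushMix w)^[s] (uniformPlay k) ∈ stdSimplex ℝ (Fin k) := by
  induction s with
  | zero => exact uniformPlay_mem hk
  | succ s ih => rw [Function.iterate_succ_apply']; exact pushMix_mem hw ih

theorem cesaroPlay_mem (hk : 0 < k) {w : (Fin k → Fin k) → ℝ}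
    (hw : w ∈ stdSimplex ℝ (Fin k → Fin k)) {m : ℕ} (hm : 0 < m) :
    cesaroPlay w m ∈ stdSimplex ℝ (Fin k) := by
  have hm' : (m : ℝ) ≠ 0 := by exact_mod_cast hm.ne'
  refine ⟨fun j => div_nonneg (Finset.sum_nonneg fun s _ => (iterate_pushMix_mem hk hw s).1 j)
    (Nat.cast_nonneg _), ?_⟩
  unfold cesaroPlay
  rw [← Finset.sum_div, Finset.sum_comm, Finset.sum_congr rfl fun s _ =>
    (iterate_pushMix_mem hk hw s).2]
  simp [hm']

theorem sum_mul_mem_Icc {ι : Type*} [Fintype ι] {p l : ι → ℝ} (hp : p ∈ stdSimplex ℝ ι)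
    (hl : ∀ j, l j ∈ Set.Icc (0 : ℝ) 1) : ∑ j, p j * l j ∈ Set.Icc (0 : ℝ) 1 :=
  ⟨Finset.sum_nonneg fun j _ => mul_nonneg (hp.1 j) (hl j).1,
    hp.2 ▸ Finset.sum_le_sum fun j _ => mul_le_of_le_one_right (hp.1 j) (hl j).2⟩

/-- Applying the mixture of maps shifts the averaged iterates by one, so the difference telescopes
to `(v 0 - v m) / m`. Unlike a chosen exact fixed point, this average is an explicit measurable
function of the weights. -/
theorem cesaroPlay_approx_fixed (hk : 0 < k) {w : (Fin k → Fin k) → ℝ}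
    (hw : w ∈ stdSimplex ℝ (Fin k → Fin k)) {m : ℕ} (hm : 0 < m) {l : Fin k → ℝ}
    (hl : ∀ j, l j ∈ Set.Icc (0 : ℝ) 1) :
    ∑ j, cesaroPlay w m j * l j ≤ (∑ f, w f * ∑ i, cesaroPlay w m i * l (f i)) + 1 / m := by
  have hm' : (0 : ℝ) < m := by exact_mod_cast hm
  set v : ℕ → ℝ := fun s => ∑ j, (pushMix w)^[s] (uniformPlay k) j * l j with hv
  have h1 : ∑ j, cesaroPlay w m j * l j = (∑ s ∈ Finset.range m, v s) / m := by
    simp only [cesaroPlay, hv, div_mul_eq_mul_div, ← Finset.sum_div, Finset.sum_mul]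
    rw [Finset.sum_comm]
  have h2 : ∑ f, w f * ∑ i, cesaroPlay w m i * l (f i) =
      (∑ s ∈ Finset.range m, v (s + 1)) / m := by
    simp only [hv, Function.iterate_succ_apply', sum_pushMix_mul, cesaroPlay, Finset.mul_sum,
      div_mul_eq_mul_div, Finset.sum_mul, Finset.sum_div]
    rw [Finset.sum_comm]
    rw [Finset.sum_comm (s := Finset.range m)]
    rw [Finset.sum_comm]
    refine Finset.sum_congr rfl fun f _ => ?_
    rw [Finset.sum_comm]
    simp only [mul_div_assoc]
  have h3 := Finset.sum_range_succ_sub_sum v (n := m)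
  have h4 := Finset.sum_range_succ' v m
  have h5 := (sum_mul_mem_Icc (iterate_pushMix_mem hk hw 0) hl).2
  have h6 := (sum_mul_mem_Icc (iterate_pushMix_mem hk hw m) hl).1
  rw [h1, h2, ← add_div]
  gcongr
  have e0 : v 0 ≤ 1 := h5
  have em : 0 ≤ v m := h6
  linarith

/-- The multiplicative weights for the cumulative losses `G`. -/
noncomputable def hedgeWeight {F : Type*} [Fintype F] (η : ℝ) (G : F → ℝ) : F → ℝ :=
  fun f => Real.exp (-η * G f) / ∑ g, Real.exp (-η * G g)

theorem hedgeWeight_mem {F : Type*} [Fintype F] [Nonempty F] (η : ℝ) (G : F → ℝ) :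
    hedgeWeight η G ∈ stdSimplex ℝ F := by
  have hpos : 0 < ∑ g, Real.exp (-η * G g) :=
    Finset.sum_pos (fun g _ => Real.exp_pos _) Finset.univ_nonempty
  refine ⟨fun f => div_nonneg (Real.exp_pos _).le hpos.le, ?_⟩
  unfold hedgeWeight
  rw [← Finset.sum_div, div_self hpos.ne']

/-- The product of `1 - x + x² / 2` and `1 + x + x² / 2` is `1 + x⁴ / 4`. -/
theorem exp_neg_le_quadratic {x : ℝ} (hx : 0 ≤ x) : Real.exp (-x) ≤ 1 - x + x ^ 2 / 2 := by
  have h := Real.quadratic_le_exp_of_nonneg hx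
  have hpos : 0 < 1 + x + x ^ 2 / 2 := by positivity
  calc Real.exp (-x) ≤ (1 + x + x ^ 2 / 2)⁻¹ := by
        rw [Real.exp_neg]; exact inv_anti₀ hpos h
    _ ≤ _ := by
        rw [inv_le_iff_one_le_mul₀ hpos]
        nlinarith [pow_nonneg hx 4]

/-- One step of the potential argument for multiplicative weights. -/
theorem sum_exp_add_le {F : Type*} [Fintype F] [Nonempty F] {η : ℝ} (hη : 0 ≤ η) (G : F → ℝ)
    {x : F → ℝ} (hx : ∀ f, x f ∈ Set.Icc (0 : ℝ) 1) :
    ∑ f, Real.exp (-η * (G f + x f)) ≤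
      (∑ f, Real.exp (-η * G f)) * Real.exp (-η * (∑ f, hedgeWeight η G f * x f) + η ^ 2 / 2) := by
  have hpos : 0 < ∑ g, Real.exp (-η * G g) :=
    Finset.sum_pos (fun g _ => Real.exp_pos _) Finset.univ_nonempty
  set W := ∑ g, Real.exp (-η * G g)
  have hw : ∀ f, Real.exp (-η * G f) = W * hedgeWeight η G f := fun f =>
    (mul_div_cancel₀ _ hpos.ne').symm
  calc ∑ f, Real.exp (-η * (G f + x f))
      ≤ ∑ f, W * (hedgeWeight η G f * (1 + η ^ 2 / 2) - η * (hedgeWeight η G f * x f)) := by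
        refine Finset.sum_le_sum fun f _ => ?_
        have h1 := exp_neg_le_quadratic (mul_nonneg hη (hx f).1)
        have h2 : (η * x f) ^ 2 ≤ η ^ 2 := by
          rw [mul_pow]
          exact mul_le_of_le_one_right (sq_nonneg _) (pow_le_one₀ (hx f).1 (hx f).2)
        have h3 : 0 ≤ hedgeWeight η G f := (hedgeWeight_mem η G).1 f
        have h4 : Real.exp (-η * x f) ≤ 1 - η * x f + η ^ 2 / 2 := by
          rw [neg_mul]; linarith
        rw [mul_add, Real.exp_add, hw, mul_assoc]
        calc W * (hedgeWeight η G f * Real.exp (-η * x f))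
            ≤ W * (hedgeWeight η G f * (1 - η * x f + η ^ 2 / 2)) :=
              mul_le_mul_of_nonneg_left (mul_le_mul_of_nonneg_left h4 h3) hpos.le
          _ = _ := by ring
    _ = W * (-η * (∑ f, hedgeWeight η G f * x f) + η ^ 2 / 2 + 1) := by
        rw [← Finset.mul_sum, Finset.sum_sub_distrib, ← Finset.sum_mul, ← Finset.mul_sum,
          (hedgeWeight_mem η G).2]
        ring
    _ ≤ _ := mul_le_mul_of_nonneg_left (Real.add_one_le_exp _) hpos.le

/-- The mixed strategy for the cumulative losses `G` of the maps. -/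
noncomputable def swapPlay (η : ℝ) (m : ℕ) (G : (Fin k → Fin k) → ℝ) : Fin k → ℝ :=
  cesaroPlay (hedgeWeight η G) m

/-- The cumulative losses of the maps. -/
noncomputable def swapLoss (η : ℝ) (m : ℕ) (L : ℕ → Fin k → ℝ) : ℕ → (Fin k → Fin k) → ℝ
  | 0 => 0
  | t + 1 => fun f => swapLoss η m L t f + ∑ i, swapPlay η m (swapLoss η m L t) i * L t (f i)

theorem swapLoss_congr (η : ℝ) (m : ℕ) {L L' : ℕ → Fin k → ℝ} {t : ℕ}
    (h : ∀ s < t, L s = L' s) : swapLoss η m L t = swapLoss η m L' t := by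
  induction t with
  | zero => rfl
  | succ t ih =>
    funext f
    simp only [swapLoss, ih fun s hs => h s (hs.trans t.lt_succ_self), h t t.lt_succ_self]

theorem measurable_swapPlay (η : ℝ) (m : ℕ) : Measurable (swapPlay (k := k) η m) := by
  have hw : Measurable (hedgeWeight (F := Fin k → Fin k) η) := by
    unfold hedgeWeight; fun_prop
  have hit : ∀ s, Measurable fun w : (Fin k → Fin k) → ℝ => (pushMix w)^[s] (uniformPlay k) := by
    intro s
    induction s with
    | zero => exact measurable_const
    | succ s ih =>
      simp only [Function.iterate_succ_apply']
      refine measurable_pi_iff.2 fun j => Finset.measurable_sum _ fun f _ =>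
        (measurable_pi_apply f).mul (Finset.measurable_sum _ fun i _ => ?_)
      split_ifs
      exacts [(measurable_pi_apply i).comp ih, measurable_const]
  have hc : Measurable fun w : (Fin k → Fin k) → ℝ => cesaroPlay w m :=
    measurable_pi_iff.2 fun j => (Finset.measurable_sum _ fun s _ =>
      (measurable_pi_apply j).comp (hit s)).div_const _
  exact hc.comp hw

theorem measurable_swapLoss (η : ℝ) (m : ℕ) {X : Type*} [MeasurableSpace X]
    {L : X → ℕ → Fin k → ℝ} (hL : ∀ t, Measurable fun x => L x t) (t : ℕ) :
    Measurable fun x => swapLoss η m (L x) t := by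
  induction t with
  | zero => exact measurable_const
  | succ t ih =>
    refine measurable_pi_iff.2 fun f => ((measurable_pi_apply f).comp ih).add
      (Finset.measurable_sum _ fun i _ => ?_)
    exact ((measurable_pi_apply i).comp ((measurable_swapPlay η m).comp ih)).mul
      ((measurable_pi_apply (f i)).comp (hL t))

/-- Zero losses give equal weights, which are invariant under composing the maps with a
transposition. The image is therefore constant; this yields the required uniform start. -/
theorem pushMix_hedgeWeight_zero (η : ℝ) (hk : 0 < k) :
    pushMix (hedgeWeight η 0) (uniformPlay k) = uniformPlay k := by
  have : Nonempty (Fin k) := ⟨⟨0, hk⟩⟩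
  have hmem := pushMix_mem (hedgeWeight_mem η (0 : (Fin k → Fin k) → ℝ)) (uniformPlay_mem hk)
  have hconst : ∀ j j', pushMix (hedgeWeight η 0) (uniformPlay k) j =
      pushMix (hedgeWeight η 0) (uniformPlay k) j' := by
    intro j j'
    unfold pushMix
    rw [← Equiv.sum_comp ((Equiv.refl (Fin k)).arrowCongr (Equiv.swap j j'))]
    refine Finset.sum_congr rfl fun f _ => ?_
    congr 1
    refine Finset.sum_congr rfl fun i _ => ?_
    have : Equiv.swap j j' (f i) = j ↔ f i = j' := by
      rw [Equiv.swap_apply_eq_iff, Equiv.swap_apply_left]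
    simp [this]
  funext j
  have hk' : (k : ℝ) ≠ 0 := by exact_mod_cast hk.ne'
  have h := hmem.2
  rw [Finset.sum_congr rfl fun j' _ => hconst j' j, Finset.sum_const, Finset.card_univ,
    Fintype.card_fin, nsmul_eq_mul] at h
  unfold uniformPlay at h ⊢
  field_simp
  linarith

theorem swapPlay_zero (η : ℝ) {m : ℕ} (hk : 0 < k) (hm : 0 < m) :
    swapPlay η m (0 : (Fin k → Fin k) → ℝ) = uniformPlay k := by
  have hm' : (m : ℝ) ≠ 0 := by exact_mod_cast hm.ne'
  funext j
  unfold swapPlay cesaroPlay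
  rw [Finset.sum_congr rfl fun s _ => by
    rw [Function.iterate_fixed (pushMix_hedgeWeight_zero η hk) s]]
  simp [hm']

/-- The no-swap-regret algorithm with learning rate `η`, the fixed points being approximated by `m`
iterations. -/
noncomputable def swapAlgorithm (η : ℝ) {m : ℕ} (hk : 0 < k) (hm : 0 < m) : OnlineAlgorithm k where
  play t l := swapPlay η m (swapLoss η m (fun s => if h : s < t then l ⟨s, h⟩ else 0) t)
  play_mem t l := by
    have : Nonempty (Fin k) := ⟨⟨0, hk⟩⟩
    exact cesaroPlay_mem hk (hedgeWeight_mem _ _) hm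
  play_zero l j := by
    show swapPlay η m 0 j = _
    rw [swapPlay_zero η hk hm]; rfl
  measurable_play t := by
    refine (measurable_swapPlay η m).comp (measurable_swapLoss η m (X := Fin t → Fin k → ℝ)
      (L := fun l s => if h : s < t then l ⟨s, h⟩ else 0) (fun s => ?_) t)
    by_cases h : s < t
    · simp only [h, dif_pos]; exact measurable_pi_apply _
    · simp only [h, dif_neg, not_false_eq_true]; exact measurable_const

theorem swapAlgorithm_play (η : ℝ) {m : ℕ} (hk : 0 < k) (hm : 0 < m) (L : ℕ → Fin k → ℝ) (t : ℕ) :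
    (swapAlgorithm η hk hm).play t (fun s => L s) = swapPlay η m (swapLoss η m L t) := by
  show swapPlay η m _ = _
  congr 1
  refine swapLoss_congr η m fun s hs => ?_
  simp [hs]

/-- The potential argument with `k ^ k` experts gives `log (k ^ k) / η + T * η / 2`; the inexact
fixed points add `1 / m` per period. -/
theorem swapAlgorithm_regret_le {η : ℝ} (hη : 0 < η) {m : ℕ} (hk : 0 < k) (hm : 0 < m)
    {L : ℕ → Fin k → ℝ} (hL : ∀ t j, L t j ∈ Set.Icc (0 : ℝ) 1) (f : Fin k → Fin k) (T : ℕ) :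
    ∑ t ∈ Finset.range T, (∑ j, (swapAlgorithm η hk hm).play t (fun s => L s) j * L t j -
        ∑ j, (swapAlgorithm η hk hm).play t (fun s => L s) j * L t (f j)) ≤
      k * Real.log k / η + T * η / 2 + T / m := by
  have hne : Nonempty (Fin k) := ⟨⟨0, hk⟩⟩
  simp only [swapAlgorithm_play]
  set G := swapLoss η m L with hG
  set p : ℕ → Fin k → ℝ := fun t => swapPlay η m (G t) with hp
  have hpmem : ∀ t, p t ∈ stdSimplex ℝ (Fin k) := fun t =>
    cesaroPlay_mem hk (hedgeWeight_mem _ _) hm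
  set x : ℕ → (Fin k → Fin k) → ℝ := fun t g => ∑ i, p t i * L t (g i) with hx
  have hGsucc : ∀ t g, G (t + 1) g = G t g + x t g := fun t g => rfl
  have hxmem : ∀ t g, x t g ∈ Set.Icc (0 : ℝ) 1 := fun t g =>
    sum_mul_mem_Icc (hpmem t) fun i => hL t (g i)
  set y : ℕ → ℝ := fun t => ∑ g, hedgeWeight η (G t) g * x t g with hy
  have hfix : ∀ t, ∑ j, p t j * L t j ≤ y t + 1 / m := fun t =>
    cesaroPlay_approx_fixed hk (hedgeWeight_mem _ _) hm (hL t)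
  have hpot : ∀ t, ∑ g, Real.exp (-η * G t g) ≤
      (k : ℝ) ^ k * Real.exp (-η * (∑ s ∈ Finset.range t, y s) + t * (η ^ 2 / 2)) := by
    intro t
    induction t with
    | zero => simp [hG, swapLoss]
    | succ t ih =>
      refine (sum_exp_add_le hη.le (G t) (hxmem t)).trans ?_
      refine (mul_le_mul_of_nonneg_right ih (Real.exp_pos _).le).trans (le_of_eq ?_)
      rw [mul_assoc, ← Real.exp_add, Finset.sum_range_succ]
      congr 2
      push_cast
      ring
  have hGsum : ∀ t, G t f = ∑ s ∈ Finset.range t, x s f := by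
    intro t
    induction t with
    | zero => rfl
    | succ t ih => rw [hGsucc, ih, Finset.sum_range_succ]
  have hk' : (0 : ℝ) < k := by exact_mod_cast hk
  have hmain : -η * (∑ s ∈ Finset.range T, x s f) ≤
      k * Real.log k + (-η * (∑ s ∈ Finset.range T, y s) + T * (η ^ 2 / 2)) := by
    rw [← Real.log_pow, ← Real.exp_le_exp, Real.exp_add, Real.exp_log (by positivity), ← hGsum]
    exact (Finset.single_le_sum (f := fun g => Real.exp (-η * G T g))
      (fun g _ => (Real.exp_pos _).le) (Finset.mem_univ f)).trans (hpot T)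
  have hreg : ∑ s ∈ Finset.range T, y s - ∑ s ∈ Finset.range T, x s f ≤
      k * Real.log k / η + T * η / 2 := by
    rw [show k * Real.log k / η + T * η / 2 = (k * Real.log k + T * (η ^ 2 / 2)) / η by
      field_simp, le_div_iff₀ hη]
    linarith
  calc ∑ t ∈ Finset.range T, (∑ j, p t j * L t j - ∑ j, p t j * L t (f j))
      ≤ ∑ t ∈ Finset.range T, (y t + 1 / m - x t f) :=
        Finset.sum_le_sum fun t _ => sub_le_sub_right (hfix t) _
    _ = (∑ s ∈ Finset.range T, y s - ∑ s ∈ Finset.range T, x s f) + T / m := by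
        rw [Finset.sum_sub_distrib, Finset.sum_add_distrib, Finset.sum_const, Finset.card_range,
          nsmul_eq_mul]
        ring
    _ ≤ _ := by linarith

theorem exists_isNoSwapRegret {k T : ℕ} (hk : 0 < k) (hT : 0 < T) :
    ∃ A : OnlineAlgorithm k, A.IsNoSwapRegret T := by
  have hT' : (0 : ℝ) < T := by exact_mod_cast hT
  rcases Nat.lt_or_ge k 2 with hk1 | hk2
  -- Here the bound is 0 and leaves no room for the error `1 / m`, but the identity is the only map.
  · obtain rfl : k = 1 := by omega
    refine ⟨swapAlgorithm 1 hk one_pos, fun L _ f => ?_⟩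
    obtain rfl : f = id := Subsingleton.elim _ _
    simp [OnlineAlgorithm.regret]
  have hk' : (2 : ℝ) ≤ k := by exact_mod_cast hk2
  have hlog : 0 < Real.log k := Real.log_pos (by linarith)
  set a := √(2 * Real.log k / T) with ha
  have ha0 : 0 < a := by positivity
  have hsq : a ^ 2 = 2 * Real.log k / T := Real.sq_sqrt (by positivity)
  have hkk : √k < k := by
    rw [Real.sqrt_lt' (by linarith)]; nlinarith
  have hk0 : 0 < √(k : ℝ) := by positivity
  have hksq : √(k : ℝ) ^ 2 = k := Real.sq_sqrt (by linarith)
  -- With learning rate `√k * a` the Hedge regret is `√k * a` per period, below the allowed `k * a`.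
  -- The difference pays for `1 / m`.
  obtain ⟨m, hm⟩ := exists_nat_gt (1 / ((k - √k) * a))
  have hgap : 0 < (k - √k) * a := mul_pos (by linarith) ha0
  have hm0 : 0 < m := by
    have : (0 : ℝ) < m := lt_trans (by positivity) hm
    exact_mod_cast this
  have hm0' : (0 : ℝ) < m := by exact_mod_cast hm0
  refine ⟨swapAlgorithm (√k * a) hk hm0, fun L hL f => ?_⟩
  unfold OnlineAlgorithm.regret
  rw [div_le_iff₀ hT']
  refine (swapAlgorithm_regret_le (by positivity) hk hm0 hL f T).trans ?_
  have h1 : k * Real.log k / (√k * a) = T * (√k * a) / 2 := by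
    have hl : Real.log k = a ^ 2 * T / 2 := by rw [hsq]; field_simp
    rw [hl, div_eq_iff (by positivity)]
    nlinarith [hksq]
  have h2 : 1 / (m : ℝ) ≤ (k - √k) * a := by
    rw [div_le_iff₀ hm0', ← div_le_iff₀' hgap]
    exact hm.le
  rw [h1]
  calc T * (√k * a) / 2 + T * (√k * a) / 2 + T / m = T * (√k * a) + T * (1 / m) := by ring
    _ ≤ T * (√k * a) + T * ((k - √k) * a) := by gcongr
    _ = _ := by ring

end SwapRegret

end LargeGame

/-! ### Expected utilities -/

namespace LargeGame

section Expect

variable {n k : ℕ}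

theorem prod_update_apply (p : Fin n → Fin k → ℝ) (i : Fin n) (x : Fin k → ℝ)
    (a : Fin n → Fin k) :
    ∏ i', (Function.update p i x) i' (a i') =
      x (a i) * ∏ i' ∈ Finset.univ.erase i, p i' (a i') := by
  rw [← Finset.mul_prod_erase _ _ (Finset.mem_univ i), Function.update_self]
  congr 1
  refine Finset.prod_congr rfl fun i' hi' => ?_
  rw [Function.update_of_ne (Finset.ne_of_mem_erase hi')]

theorem expect_update_single (p : Fin n → Fin k → ℝ) (i : Fin n) (j : Fin k)
    (v : (Fin n → Fin k) → ℝ) :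
    expect (Function.update p i (Pi.single j 1)) v =
      ∑ a with a i = j, (∏ i' ∈ Finset.univ.erase i, p i' (a i')) * v a := by
  unfold expect
  rw [Finset.sum_filter]
  refine Finset.sum_congr rfl fun a _ => ?_
  rw [prod_update_apply, Pi.single_apply]
  split_ifs <;> simp

theorem expect_eq_sum_single (p : Fin n → Fin k → ℝ) (i : Fin n) (v : (Fin n → Fin k) → ℝ) :
    expect p v = ∑ j, p i j * expect (Function.update p i (Pi.single j 1)) v := by
  simp only [expect_update_single, Finset.sum_filter, Finset.mul_sum]
  rw [Finset.sum_comm]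
  refine Finset.sum_congr rfl fun a _ => ?_
  rw [← Finset.mul_prod_erase _ _ (Finset.mem_univ i)]
  simp [mul_assoc]

/-- The expected utility of player `i` if she applies `f` to her action. -/
theorem expect_deviation (p : Fin n → Fin k → ℝ) (i : Fin n) (f : Fin k → Fin k)
    (v : (Fin n → Fin k) → ℝ) :
    expect p (fun a => v (Function.update a i (f (a i)))) =
      ∑ j, p i j * expect (Function.update p i (Pi.single (f j) 1)) v := by
  rw [expect_eq_sum_single p i]
  refine Finset.sum_congr rfl fun j _ => ?_
  rw [expect_update_single, expect_update_single]
  congr 1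
  refine Finset.sum_bij' (fun a _ => Function.update a i (f j)) (fun a _ => Function.update a i j)
    ?_ ?_ ?_ ?_ ?_
  · intro a _; simp
  · intro a _; simp
  · intro a ha
    have : a i = j := by simpa using ha
    simp [← this]
  · intro a ha
    have : a i = f j := by simpa using ha
    simp [← this]
  · intro a ha
    have : a i = j := by simpa using ha
    rw [this]
    congr 1
    refine Finset.prod_congr rfl fun i' hi' => ?_
    rw [Function.update_of_ne (Finset.ne_of_mem_erase hi')]

theorem sum_prod_eq_one {p : Fin n → Fin k → ℝ} (hp : ∀ i, p i ∈ stdSimplex ℝ (Fin k)) :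
    ∑ a : Fin n → Fin k, ∏ i, p i (a i) = 1 := by
  have h := Finset.prod_univ_sum (fun _ : Fin n => (Finset.univ : Finset (Fin k))) p
  rw [Fintype.piFinset_univ] at h
  rw [← h]
  exact Finset.prod_eq_one fun i _ => (hp i).2

theorem prod_mem_stdSimplex {p : Fin n → Fin k → ℝ} (hp : ∀ i, p i ∈ stdSimplex ℝ (Fin k)) :
    (fun a : Fin n → Fin k => ∏ i, p i (a i)) ∈ stdSimplex ℝ (Fin n → Fin k) :=
  ⟨fun a => Finset.prod_nonneg fun i _ => (hp i).1 (a i), sum_prod_eq_one hp⟩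

theorem expect_mem_Icc {p : Fin n → Fin k → ℝ} (hp : ∀ i, p i ∈ stdSimplex ℝ (Fin k))
    {v : (Fin n → Fin k) → ℝ} (hv : ∀ a, v a ∈ Set.Icc (0 : ℝ) 1) :
    expect p v ∈ Set.Icc (0 : ℝ) 1 :=
  sum_mul_mem_Icc (prod_mem_stdSimplex hp) hv

theorem abs_sum_mul_le {ι : Type*} [Fintype ι] {p l : ι → ℝ} (hp : p ∈ stdSimplex ℝ ι) {B : ℝ}
    (hl : ∀ j, |l j| ≤ B) : |∑ j, p j * l j| ≤ B := by
  calc |∑ j, p j * l j| ≤ ∑ j, p j * B := by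
        refine (Finset.abs_sum_le_sum_abs _ _).trans (Finset.sum_le_sum fun j _ => ?_)
        rw [abs_mul, abs_of_nonneg (hp.1 j)]
        exact mul_le_mul_of_nonneg_left (hl j) (hp.1 j)
    _ = B := by rw [← Finset.sum_mul, hp.2, one_mul]

theorem update_mem_stdSimplex {p : Fin n → Fin k → ℝ} (hp : ∀ i, p i ∈ stdSimplex ℝ (Fin k))
    (i : Fin n) {x : Fin k → ℝ} (hx : x ∈ stdSimplex ℝ (Fin k)) (i' : Fin n) :
    Function.update p i x i' ∈ stdSimplex ℝ (Fin k) := by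
  rcases eq_or_ne i' i with rfl | h
  · rwa [Function.update_self]
  · rw [Function.update_of_ne h]; exact hp i'

/-- Changing the mixed strategy of a player with influence `lam` on `v` changes the expectation of
`v` by at most `lam`. -/
theorem abs_expect_update_sub_le {p : Fin n → Fin k → ℝ} (hp : ∀ i, p i ∈ stdSimplex ℝ (Fin k))
    (i : Fin n) {x y : Fin k → ℝ} (hx : x ∈ stdSimplex ℝ (Fin k)) (hy : y ∈ stdSimplex ℝ (Fin k))
    {v : (Fin n → Fin k) → ℝ} {lam : ℝ} (hv : ∀ a b, |v a - v (Function.update a i b)| ≤ lam) :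
    |expect (Function.update p i x) v - expect (Function.update p i y) v| ≤ lam := by
  set E : Fin k → ℝ := fun j => expect (Function.update p i (Pi.single j 1)) v with hE
  have hsum : ∀ z : Fin k → ℝ, expect (Function.update p i z) v = ∑ j, z j * E j := by
    intro z
    rw [expect_eq_sum_single _ i]
    simp [hE]
  have hdiff : ∀ j j', |E j - E j'| ≤ lam := by
    intro j j'
    -- Writing `E j'` under the same product distribution as `E j`, with the action of `i`
    -- overwritten, lets the bound `hv` act pointwise.
    have h1 : E j' = expect (Function.update p i (Pi.single j 1))
        (fun a => v (Function.update a i j')) := by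
      rw [expect_deviation _ i (fun _ => j')]
      simp [hE, Pi.single_apply]
    rw [h1, hE]
    simp only [expect]
    rw [← Finset.sum_sub_distrib]
    simp only [← mul_sub]
    exact abs_sum_mul_le
      (prod_mem_stdSimplex (update_mem_stdSimplex hp i (single_mem_stdSimplex ℝ j)))
      fun a => hv a j'
  rw [hsum, hsum]
  have h2 : ∑ j, x j * E j - ∑ j, y j * E j = ∑ j, x j * (∑ j', y j' * (E j - E j')) := by
    simp only [mul_sub, Finset.sum_sub_distrib, ← Finset.sum_mul, hx.2, hy.2, one_mul]
  rw [h2]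
  exact abs_sum_mul_le hx fun j => abs_sum_mul_le hy fun j' => hdiff j j'

theorem averagePlay_mem {T : ℕ} (hT : 0 < T) {π : Fin n → ℕ → Fin k → ℝ}
    (hπ : ∀ i t, π i t ∈ stdSimplex ℝ (Fin k)) :
    averagePlay T π ∈ stdSimplex ℝ (Fin n → Fin k) := by
  have hT' : (T : ℝ) ≠ 0 := by exact_mod_cast hT.ne'
  refine ⟨fun a => div_nonneg (Finset.sum_nonneg fun t _ =>
    Finset.prod_nonneg fun i _ => (hπ i t).1 _) (Nat.cast_nonneg _), ?_⟩
  unfold averagePlay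
  rw [← Finset.sum_div, Finset.sum_comm, Finset.sum_congr rfl fun t _ =>
    sum_prod_eq_one fun i => hπ i t]
  simp [hT']

theorem sum_averagePlay_mul (T : ℕ) (π : Fin n → ℕ → Fin k → ℝ) (v : (Fin n → Fin k) → ℝ) :
    ∑ a, averagePlay T π a * v a =
      (∑ t ∈ Finset.range T, expect (fun i => π i t) v) / T := by
  unfold averagePlay expect
  simp only [div_mul_eq_mul_div, ← Finset.sum_div, Finset.sum_mul]
  rw [Finset.sum_comm]

theorem IsApproxCE.mono {η η' : ℝ} (h : η ≤ η') {v : Fin n → (Fin n → Fin k) → ℝ}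
    {D : (Fin n → Fin k) → ℝ} (hD : IsApproxCE η v D) : IsApproxCE η' v D :=
  ⟨hD.1, fun i f => by linarith [hD.2 i f]⟩

end Expect

/-! ### The queries of NRMEDIAN -/

section NRMedianAnalysis

variable {𝒯 : Type*} {n k : ℕ}

theorem strategy_mem (A : OnlineAlgorithm k) (Lam : ℕ → Fin n → Fin k → 𝒯 → ℝ) (i : Fin n)
    (θ : 𝒯) (t : ℕ) : strategy A Lam i θ t ∈ stdSimplex ℝ (Fin k) := A.play_mem _ _

theorem strategy_congr (A : OnlineAlgorithm k) {Lam Lam' : ℕ → Fin n → Fin k → 𝒯 → ℝ} {t : ℕ}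
    (h : ∀ s < t, Lam s = Lam' s) (i : Fin n) (θ : 𝒯) :
    strategy A Lam i θ t = strategy A Lam' i θ t := by
  unfold strategy
  congr 1
  funext s j
  rw [h s s.2]

theorem lossQuery_congr (A : OnlineAlgorithm k) (u : Fin n → 𝒯 → (Fin n → Fin k) → ℝ)
    {Lam Lam' : ℕ → Fin n → Fin k → 𝒯 → ℝ} {t : ℕ} (h : ∀ s < t, Lam s = Lam' s) (i : Fin n)
    (j : Fin k) (θ : 𝒯) : lossQuery A u Lam t i j θ = lossQuery A u Lam' t i j θ := by
  unfold lossQuery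
  simp only [strategy_congr A h]

/-- The losses `Lam` are fixed, so a type only selects which of them its player reads. The type of
`i` herself drops out, because her strategy is replaced by the action `j` and `θ` is part of the
query. -/
theorem lossQuery_isSensitive (A : OnlineAlgorithm k) {u : Fin n → 𝒯 → (Fin n → Fin k) → ℝ}
    {lam : ℝ} (hlam : 0 ≤ lam) (hu : IsLarge u lam) (Lam : ℕ → Fin n → Fin k → 𝒯 → ℝ) (t : ℕ)
    (i : Fin n) (j : Fin k) (θ : 𝒯) : (lossQuery A u Lam t i j θ).IsSensitive lam := by
  intro τ i₀ θ₀
  unfold lossQuery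
  rcases eq_or_ne i₀ i with rfl | hne
  · have : Function.update (fun i' => strategy A Lam i' (Function.update τ i₀ θ₀ i') t) i₀
        (Pi.single j 1) =
        Function.update (fun i' => strategy A Lam i' (τ i') t) i₀ (Pi.single j 1) := by
      funext i'
      rcases eq_or_ne i' i₀ with rfl | h
      · simp
      · simp [Function.update_of_ne h]
    simp [this, hlam]
  · set p := Function.update (fun i' => strategy A Lam i' (τ i') t) i (Pi.single j 1) with hp
    have hpmem : ∀ i', p i' ∈ stdSimplex ℝ (Fin k) :=
      update_mem_stdSimplex (fun i' => strategy_mem A Lam i' (τ i') t) i (single_mem_stdSimplex ℝ j)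
    have h1 : p = Function.update p i₀ (p i₀) := by simp
    have h2 : Function.update (fun i' => strategy A Lam i' (Function.update τ i₀ θ₀ i') t) i
        (Pi.single j 1) = Function.update p i₀ (strategy A Lam i₀ θ₀ t) := by
      funext i'
      rcases eq_or_ne i' i₀ with rfl | h
      · simp [Function.update_of_ne hne]
      · rcases eq_or_ne i' i with rfl | h'
        · simp [Function.update_of_ne h, hp]
        · simp [Function.update_of_ne h, Function.update_of_ne h', hp]
    have h3 := abs_expect_update_sub_le hpmem i₀ (hpmem i₀) (strategy_mem A Lam i₀ θ₀ t)
      (v := u i θ) (fun a b => hu i₀ i hne θ a b)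
    rw [← h1, ← h2] at h3
    simp only
    rw [abs_le] at h3 ⊢
    constructor <;> linarith [h3.1, h3.2]

variable [Fintype 𝒯]

theorem measurable_decode (e : Fin n × Fin k × 𝒯 ≃ Fin (n * k * Fintype.card 𝒯)) (r t : ℕ)
    (i : Fin n) (j : Fin k) (θ : 𝒯) :
    Measurable fun a : Fin r → ℝ => decode e a t i j θ := by
  unfold decode
  split_ifs
  exacts [measurable_pi_apply _, measurable_const]

theorem nrQuerier_isAdmissible (A : OnlineAlgorithm k) {u : Fin n → 𝒯 → (Fin n → Fin k) → ℝ}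
    {lam : ℝ} (hlam : 0 ≤ lam) (hu : IsLarge u lam)
    (e : Fin n × Fin k × 𝒯 ≃ Fin (n * k * Fintype.card 𝒯)) :
    (nrQuerier A u e).IsAdmissible lam := by
  constructor
  · intro r
    unfold nrQuerier
    split_ifs with h
    · refine measurable_pi_iff.2 fun τ => ?_
      simp only [lossQuery, expect]
      refine ((measurable_const.sub (Finset.measurable_sum _ fun b _ =>
        (Finset.measurable_prod _ fun i' _ => ?_).mul_const _)).add_const 1).div_const 3
      simp only [Function.update_apply]
      split_ifs
      · exact measurable_const
      · exact (measurable_pi_apply _).comp ((A.measurable_play _).comp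
          (measurable_pi_iff.2 fun s => measurable_pi_iff.2 fun j => measurable_decode e r s _ j _))
    · exact measurable_const
  · intro r a
    unfold nrQuerier
    split_ifs
    · exact lossQuery_isSensitive A hlam hu _ _ _ _ _
    · intro τ i θ
      simp [hlam]

theorem nrQuerier_index (A : OnlineAlgorithm k) (u : Fin n → 𝒯 → (Fin n → Fin k) → ℝ)
    (e : Fin n × Fin k × 𝒯 ≃ Fin (n * k * Fintype.card 𝒯)) (t : ℕ) (i : Fin n) (j : Fin k) (θ : 𝒯)
    (a : Fin (t * (n * k * Fintype.card 𝒯) + e (i, j, θ)) → ℝ) :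
    nrQuerier A u e (t * (n * k * Fintype.card 𝒯) + e (i, j, θ)) a =
      lossQuery A u (decode e a) t i j θ := by
  have hN : 0 < n * k * Fintype.card 𝒯 := Fin.pos (e (i, j, θ))
  have hlt := (e (i, j, θ)).2
  have hdiv : (t * (n * k * Fintype.card 𝒯) + e (i, j, θ)) / (n * k * Fintype.card 𝒯) = t := by
    rw [mul_comm t, Nat.mul_add_div hN, Nat.div_eq_of_lt hlt, add_zero]
  have hmod : e.symm ⟨(t * (n * k * Fintype.card 𝒯) + e (i, j, θ)) % (n * k * Fintype.card 𝒯),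
      Nat.mod_lt _ hN⟩ = (i, j, θ) := by
    rw [Equiv.symm_apply_eq]
    refine Fin.ext ?_
    simp only [mul_comm t, Nat.mul_add_mod, Nat.mod_eq_of_lt hlt]
  unfold nrQuerier
  rw [dif_pos hN]
  simp only [hdiv, hmod]

/-- If all answers are accurate, the noisy losses of NRMEDIAN are accurate. -/
theorem abs_nrMedianShared_sub_le (A : OnlineAlgorithm k) (M : QueryMechanism 𝒯 n)
    (u : Fin n → 𝒯 → (Fin n → Fin k) → ℝ)
    (e : Fin n × Fin k × 𝒯 ≃ Fin (n * k * Fintype.card 𝒯)) (T : ℕ) (τ : Fin n → 𝒯) (ω : M.Ω)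
    {err : ℝ} (hacc : ∀ r : Fin (T * (n * k * Fintype.card 𝒯)),
      |M.answers (nrQuerier A u e) τ ω (T * (n * k * Fintype.card 𝒯)) r - nrQuerier A u e r
        (fun m => M.answers (nrQuerier A u e) τ ω (T * (n * k * Fintype.card 𝒯))
          ⟨m, m.isLt.trans r.isLt⟩) τ| ≤ err)
    {t : ℕ} (ht : t < T) (i : Fin n) (j : Fin k) (θ : 𝒯) :
    |nrMedianShared A M u e T τ ω t i j θ -
      lossQuery A u (nrMedianShared A M u e T τ ω) t i j θ τ| ≤ err := by
  have hidx : ∀ s < T, ∀ x, s * (n * k * Fintype.card 𝒯) + e x < T * (n * k * Fintype.card 𝒯) := by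
    intro s hs x
    have h1 := (e x).2
    have h2 := Nat.mul_le_mul_right (n * k * Fintype.card 𝒯) (Nat.succ_le_of_lt hs)
    rw [Nat.succ_mul] at h2
    omega
  have h := hacc ⟨_, hidx t ht (i, j, θ)⟩
  simp only [nrQuerier_index] at h
  have hL : nrMedianShared A M u e T τ ω t i j θ =
      M.answers (nrQuerier A u e) τ ω (T * (n * k * Fintype.card 𝒯)) ⟨_, hidx t ht (i, j, θ)⟩ := by
    unfold nrMedianShared decode
    rw [dif_pos (hidx t ht (i, j, θ))]
  rw [hL]
  -- The query of period `t` uses only losses of earlier periods, all answered before its round, so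
  -- decoding the full transcript gives the same query as decoding the answers then available.
  refine le_of_eq_of_le (congrArg (fun Q : Query 𝒯 n => |_ - Q τ|)
    (lossQuery_congr A u (fun s hs => ?_) i j θ)) h
  funext i' j' θ'
  have h1 : s * (n * k * Fintype.card 𝒯) + e (i', j', θ') <
      t * (n * k * Fintype.card 𝒯) + e (i, j, θ) := by
    have h1 := (e (i', j', θ')).2
    have h2 := Nat.mul_le_mul_right (n * k * Fintype.card 𝒯) (Nat.succ_le_of_lt hs)
    rw [Nat.succ_mul] at h2
    omega
  unfold nrMedianShared decode
  rw [dif_pos (hidx s (hs.trans ht) (i', j', θ')), dif_pos h1]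

theorem nrMedianShared_of_ge (A : OnlineAlgorithm k) (M : QueryMechanism 𝒯 n)
    (u : Fin n → 𝒯 → (Fin n → Fin k) → ℝ)
    (e : Fin n × Fin k × 𝒯 ≃ Fin (n * k * Fintype.card 𝒯)) {T t : ℕ} (τ : Fin n → 𝒯) (ω : M.Ω)
    (ht : T ≤ t) (i : Fin n) (j : Fin k) (θ : 𝒯) : nrMedianShared A M u e T τ ω t i j θ = 0 := by
  unfold nrMedianShared decode
  rw [dif_neg]
  have := Nat.mul_le_mul_right (n * k * Fintype.card 𝒯) ht
  omega

/-- If all answers are accurate, NRMEDIAN computes an approximate correlated equilibrium. -/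
theorem isApproxCE_nrMedian (A : OnlineAlgorithm k) (M : QueryMechanism 𝒯 n)
    {u : Fin n → 𝒯 → (Fin n → Fin k) → ℝ} (hu : ∀ i θ a, u i θ a ∈ Set.Icc (0 : ℝ) 1)
    (e : Fin n × Fin k × 𝒯 ≃ Fin (n * k * Fintype.card 𝒯)) {T : ℕ} (hT : 0 < T)
    (hA : A.IsNoSwapRegret T) (τ : Fin n → 𝒯) (ω : M.Ω) {err : ℝ} (herr : err ≤ 1 / 6)
    (hacc : ∀ r : Fin (T * (n * k * Fintype.card 𝒯)),
      |M.answers (nrQuerier A u e) τ ω (T * (n * k * Fintype.card 𝒯)) r - nrQuerier A u e r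
        (fun m => M.answers (nrQuerier A u e) τ ω (T * (n * k * Fintype.card 𝒯))
          ⟨m, m.isLt.trans r.isLt⟩) τ| ≤ err) :
    IsApproxCE (3 * (k * √(2 * Real.log k / T) + 2 * err)) (fun i => u i (τ i))
      (averagePlay T (nrMedian A M u e T τ ω)) := by
  have hT' : (0 : ℝ) < T := by exact_mod_cast hT
  set Lam := nrMedianShared A M u e T τ ω with hLam
  set π := nrMedian A M u e T τ ω with hπ
  have hπmem : ∀ i t, π i t ∈ stdSimplex ℝ (Fin k) := fun i t => strategy_mem A _ _ _ _
  refine ⟨averagePlay_mem hT hπmem, fun i f => ?_⟩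
  set q : ℕ → Fin k → ℝ := fun t j => lossQuery A u Lam t i j (τ i) τ with hq
  set L : ℕ → Fin k → ℝ := fun t j => Lam t i j (τ i) with hL
  have hplay : ∀ t, A.play t (fun s => L s) = π i t := fun t => rfl
  have hclose : ∀ t < T, ∀ j, |L t j - q t j| ≤ err := fun t ht j =>
    abs_nrMedianShared_sub_le A M u e T τ ω hacc ht i j (τ i)
  have hE : ∀ t j, expect (Function.update (fun i' => π i' t) i (Pi.single j 1)) (u i (τ i)) =
      2 - 3 * q t j := by
    intro t j
    have : q t j = ((1 - expect (Function.update (fun i' => π i' t) i (Pi.single j 1))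
      (u i (τ i))) + 1) / 3 := rfl
    rw [this]; ring
  have hqmem : ∀ t j, q t j ∈ Set.Icc (1 / 3 : ℝ) (2 / 3) := by
    intro t j
    have h := expect_mem_Icc (update_mem_stdSimplex (fun i' => hπmem i' t) i
      (single_mem_stdSimplex ℝ j)) (hu i (τ i))
    rw [hE] at h
    constructor <;> linarith [h.1, h.2]
  have hLmem : ∀ t j, L t j ∈ Set.Icc (0 : ℝ) 1 := by
    intro t j
    rcases lt_or_ge t T with ht | ht
    · have h1 := abs_le.1 (hclose t ht j)
      have h2 := hqmem t j
      constructor <;> linarith [h1.1, h1.2, h2.1, h2.2]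
    -- The regret guarantee needs losses in `[0, 1]` in all periods; the default value 0 covers
    -- those after the horizon.
    · have : L t j = 0 := nrMedianShared_of_ge A M u e τ ω ht i j (τ i)
      rw [this]; simp
  have hreg := hA L hLmem f
  unfold OnlineAlgorithm.regret at hreg
  rw [div_le_iff₀ hT'] at hreg
  simp only [hplay] at hreg
  have hdev : ∑ a, averagePlay T π a * u i (τ i) (Function.update a i (f (a i))) =
      (∑ t ∈ Finset.range T, ∑ j, π i t j * (2 - 3 * q t (f j))) / T := by
    rw [sum_averagePlay_mul T π (fun a => u i (τ i) (Function.update a i (f (a i))))]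
    congr 1
    refine Finset.sum_congr rfl fun t _ => ?_
    rw [expect_deviation]
    exact Finset.sum_congr rfl fun j _ => by rw [hE]
  have hobey : ∑ a, averagePlay T π a * u i (τ i) a =
      (∑ t ∈ Finset.range T, ∑ j, π i t j * (2 - 3 * q t j)) / T := by
    rw [sum_averagePlay_mul T π]
    congr 1
    refine Finset.sum_congr rfl fun t _ => ?_
    rw [expect_eq_sum_single _ i]
    exact Finset.sum_congr rfl fun j _ => by rw [hE]
  rw [hdev, hobey, sub_le_iff_le_add, div_le_iff₀ hT', add_mul, div_mul_cancel₀ _ hT'.ne',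
    ← sub_le_iff_le_add', ← Finset.sum_sub_distrib]
  -- Each utility is `2 - 3 q`, and replacing `q` by the noisy `L` costs `err` for the action played
  -- and `err` for the deviation.
  calc ∑ t ∈ Finset.range T, (∑ j, π i t j * (2 - 3 * q t (f j)) - ∑ j, π i t j * (2 - 3 * q t j))
      ≤ ∑ t ∈ Finset.range T, (3 * (∑ j, π i t j * L t j - ∑ j, π i t j * L t (f j)) +
          6 * err) := by
        refine Finset.sum_le_sum fun t ht => ?_
        have h1 : ∑ j, π i t j * (6 * err) = 6 * err := by
          rw [← Finset.sum_mul, (hπmem i t).2, one_mul]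
        rw [← h1, ← Finset.sum_sub_distrib, ← Finset.sum_sub_distrib, Finset.mul_sum,
          ← Finset.sum_add_distrib]
        refine Finset.sum_le_sum fun j _ => ?_
        have h2 := abs_le.1 (hclose t (Finset.mem_range.1 ht) j)
        have h3 := abs_le.1 (hclose t (Finset.mem_range.1 ht) (f j))
        have h4 : 0 ≤ π i t j * ((L t j - q t j + err) + (q t (f j) - L t (f j) + err)) :=
          mul_nonneg ((hπmem i t).1 j) (by linarith [h2.1, h3.2])
        nlinarith
    _ ≤ _ := by
        rw [Finset.sum_add_distrib, ← Finset.mul_sum, Finset.sum_const, Finset.card_range,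
          nsmul_eq_mul]
        linarith

end NRMedianAnalysis

/-! ### The error bound -/

theorem approximation_bound {n k T m : ℕ} {ε δ lam β : ℝ} (hn : 0 < n) (hk : 0 < k) (hT : 0 < T)
    (hm : 0 < m) (hε : ε ∈ Set.Ioc (0 : ℝ) 1) (hδ : δ ∈ Set.Ioc (0 : ℝ) 1)
    (hlam : lam ∈ Set.Ioc (0 : ℝ) 1) (hβ : β ∈ Set.Ioc (0 : ℝ) 1)
    (hTk : (k : ℝ) ^ 2 / (lam ^ 2 * n) ≤ T) :
    3 * (k * √(2 * Real.log k / T) + 2 * medianError n m (T * (n * k * m)) ε δ lam β) ≤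
      600 * (lam * √n * (1 + Real.log m) ^ (3 / 2 : ℝ) * (1 + Real.log (k / β)) *
        (1 + Real.log (1 / δ)) / ε) * (1 + Real.log (n * T / k ^ 2)) := by
  have hε0 := hε.1
  have hδ0 := hδ.1
  have hl0 := hlam.1
  have hβ0 := hβ.1
  have hn' : (0 : ℝ) < n := by exact_mod_cast hn
  have hT' : (0 : ℝ) < T := by exact_mod_cast hT
  have hk1 : (1 : ℝ) ≤ k := by exact_mod_cast hk
  have hm1 : (1 : ℝ) ≤ m := by exact_mod_cast hm
  have hk' : (0 : ℝ) < k := by linarith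
  have hm' : (0 : ℝ) < m := by linarith
  have hkT : (k : ℝ) ^ 2 ≤ T * (lam ^ 2 * n) := by rwa [div_le_iff₀ (by positivity)] at hTk
  have ha : 0 ≤ Real.log m := Real.log_nonneg hm1
  have hlk : 0 ≤ Real.log k := Real.log_nonneg hk1
  have hκk : Real.log k ≤ Real.log (k / β) := by
    refine Real.log_le_log hk' ?_
    rw [le_div_iff₀ hβ0]
    exact mul_le_of_le_one_right hk'.le hβ.2
  have hd : 0 ≤ Real.log (1 / δ) := Real.log_nonneg <| by
    rw [le_div_iff₀ hδ0]; linarith [hδ.2]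
  have hℓ : 0 ≤ Real.log (n * T / k ^ 2) := Real.log_nonneg <| by
    rw [le_div_iff₀ (by positivity), one_mul]
    refine hkT.trans ?_
    have : lam ^ 2 ≤ 1 := pow_le_one₀ hl0.le hlam.2
    nlinarith [mul_pos hn' hT']
  have hlogR : Real.log (2 * ((T * (n * k * m) : ℕ) : ℝ) / β) ≤
      1 + Real.log m + 3 * Real.log (k / β) + Real.log (n * T / k ^ 2) := by
    -- The factor `k²` is split off so that only `n T / k²` remains in the last logarithm; it adds
    -- `2 log k ≤ 2 log (k / β)`.
    have h1 : 2 * ((T * (n * k * m) : ℕ) : ℝ) / β =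
        2 * (m * ((k / β) * ((n * T / k ^ 2) * k ^ 2))) := by
      push_cast; field_simp
    rw [h1, Real.log_mul (by positivity) (by positivity), Real.log_mul (by positivity)
      (by positivity), Real.log_mul (by positivity) (by positivity), Real.log_mul (by positivity)
      (by positivity), Real.log_pow]
    have := Real.log_two_lt_d9
    push_cast
    linarith
  have hlogR0 : 0 ≤ Real.log (2 * ((T * (n * k * m) : ℕ) : ℝ) / β) := Real.log_nonneg <| by
    have h1 : (1 : ℝ) ≤ ((T * (n * k * m) : ℕ) : ℝ) := by
      exact_mod_cast (show 0 < T * (n * k * m) by positivity)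
    rw [le_div_iff₀ hβ0]
    linarith [hβ.2]
  have hlogδ : Real.log (4 / δ) ≤ 2 * (1 + Real.log (1 / δ)) := by
    have h1 : 4 / δ = 2 * (2 * (1 / δ)) := by ring
    rw [h1, Real.log_mul (by positivity) (by positivity), Real.log_mul (by positivity)
      (by positivity)]
    have := Real.log_two_lt_d9
    linarith
  have hlogδ0 : 0 ≤ Real.log (4 / δ) := by
    have := log_four_div_ge hδ
    have := Real.log_two_gt_d9
    linarith
  have hsqrtk : k * √(2 * Real.log k / T) ≤ lam * √n * (1 + Real.log (k / β)) := by
    have h1 : √(2 * Real.log k / T) = √(2 * Real.log k) / √T := Real.sqrt_div (by positivity) _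
    have h2 : √(2 * Real.log k) ≤ 1 + Real.log (k / β) := by
      rw [Real.sqrt_le_left (by linarith)]
      nlinarith
    -- The lower bound on `T` makes the regret comparable to the noise `lam * √n`.
    have h3 : k / √T ≤ lam * √n := by
      rw [div_le_iff₀ (by positivity)]
      refine le_of_sq_le_sq ?_ (by positivity)
      rw [mul_pow, mul_pow, Real.sq_sqrt hn'.le, Real.sq_sqrt hT'.le]
      linarith
    calc k * √(2 * Real.log k / T) = k / √T * √(2 * Real.log k) := by rw [h1]; ring
      _ ≤ _ := by gcongr
  have hpow : (1 + Real.log m) ^ (3 / 2 : ℝ) = (1 + Real.log m) * √(1 + Real.log m) := by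
    rw [Real.sqrt_eq_rpow, show (3 / 2 : ℝ) = 1 + 1 / 2 by norm_num,
      Real.rpow_add (by linarith), Real.rpow_one]
  have hsqrta : √(Real.log m) ≤ √(1 + Real.log m) := Real.sqrt_le_sqrt (by linarith)
  have hsqrt1 : 1 ≤ √(1 + Real.log m) := by rw [Real.one_le_sqrt]; linarith
  rw [hpow]
  unfold medianError
  rw [Real.sqrt_mul hn'.le]
  set a := Real.log m
  set κ := Real.log (k / β)
  set d := Real.log (1 / δ)
  set ℓ := Real.log (n * T / k ^ 2)
  have hκ : 0 ≤ κ := hlk.trans hκk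
  have hP : 1 + κ ≤ (1 + a) * √(1 + a) * (1 + κ) * (1 + d) * (1 + ℓ) := by
    have h1 : 1 ≤ (1 + a) * √(1 + a) := one_le_mul_of_one_le_of_one_le (by linarith) hsqrt1
    calc 1 + κ = 1 * (1 + κ) * 1 * 1 := by ring
      _ ≤ _ := by gcongr <;> linarith
  have hfirst : k * √(2 * Real.log k / T) ≤
      lam * √n / ε * ((1 + a) * √(1 + a) * (1 + κ) * (1 + d) * (1 + ℓ)) := by
    refine hsqrtk.trans ?_
    have : lam * √n ≤ lam * √n / ε := by
      rw [le_div_iff₀ hε0]; exact mul_le_of_le_one_right (by positivity) hε.2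
    gcongr
  have hlogR' : Real.log (2 * ((T * (n * k * m) : ℕ) : ℝ) / β) ≤
      3 * ((1 + a) * (1 + κ) * (1 + ℓ)) := by
    refine hlogR.trans ?_
    nlinarith [mul_nonneg ha hκ, mul_nonneg ha hℓ, mul_nonneg hκ hℓ,
      mul_nonneg (mul_nonneg ha hκ) hℓ]
  have hsecond : 16 * ε⁻¹ * lam * (√n * √a) * Real.log (2 * ((T * (n * k * m) : ℕ) : ℝ) / β) *
      Real.log (4 / δ) ≤
      96 * (lam * √n / ε * ((1 + a) * √(1 + a) * (1 + κ) * (1 + d) * (1 + ℓ))) := by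
    calc _ ≤ 16 * ε⁻¹ * lam * (√n * √(1 + a)) * (3 * ((1 + a) * (1 + κ) * (1 + ℓ))) *
          (2 * (1 + d)) := by gcongr
      _ = _ := by ring
  calc _ ≤ 3 * (lam * √n / ε * ((1 + a) * √(1 + a) * (1 + κ) * (1 + d) * (1 + ℓ)) +
        2 * (96 * (lam * √n / ε * ((1 + a) * √(1 + a) * (1 + κ) * (1 + d) * (1 + ℓ))))) := by
        gcongr
    -- The constant is `3 * (1 + 2 * 96)`, with `96 = 16 * 3 * 2` from the mechanism's constant and
    -- the two logarithms.
    _ = 579 * (lam * √n / ε * ((1 + a) * √(1 + a) * (1 + κ) * (1 + d) * (1 + ℓ))) := by ring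
    _ ≤ 600 * (lam * √n / ε * ((1 + a) * √(1 + a) * (1 + κ) * (1 + d) * (1 + ℓ))) := by
        gcongr; norm_num
    _ = _ := by ring

end LargeGame

/-! ### The theorem -/

theorem mainTheorem11 :
    ∃ C : ℝ, 0 < C ∧
      ∀ (𝒯 : Type*) [Fintype 𝒯] [Nonempty 𝒯] (n k T : ℕ) (ε δ lam β : ℝ),
        0 < n → 0 < k → 0 < T →
        ε ∈ Set.Ioc (0 : ℝ) 1 → δ ∈ Set.Ioc (0 : ℝ) 1 →
        lam ∈ Set.Ioc (0 : ℝ) 1 → β ∈ Set.Ioc (0 : ℝ) 1 →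
        -- the no-swap-regret algorithm and the Median Mechanism exist
        (∃ A : LargeGame.OnlineAlgorithm k, A.IsNoSwapRegret T) ∧
        (∃ M : LargeGame.QueryMechanism 𝒯 n,
          M.IsMedianMechanism ε δ lam β (T * (n * k * Fintype.card 𝒯))) ∧
        -- and with them NRMEDIAN computes an approximate correlated equilibrium
        (16 * ε⁻¹ * lam * √(n * Real.log (Fintype.card 𝒯)) *
            Real.log (2 * Fintype.card 𝒯 * n * k * T / β) * Real.log (4 / δ) ≤ 1 / 6 →
          (k : ℝ) ^ 2 / (lam ^ 2 * n) ≤ T →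
          ∀ A : LargeGame.OnlineAlgorithm k, A.IsNoSwapRegret T →
          ∀ M : LargeGame.QueryMechanism 𝒯 n,
            M.IsMedianMechanism ε δ lam β (T * (n * k * Fintype.card 𝒯)) →
          ∀ u : Fin n → 𝒯 → (Fin n → Fin k) → ℝ,
            (∀ i θ a, u i θ a ∈ Set.Icc (0 : ℝ) 1) → LargeGame.IsLarge u lam →
          ∀ (e : Fin n × Fin k × 𝒯 ≃ Fin (n * k * Fintype.card 𝒯)) (τ : Fin n → 𝒯),
            M.μ {ω | ¬ LargeGame.IsApproxCE
                (C * (lam * √n * (1 + Real.log (Fintype.card 𝒯)) ^ (3 / 2 : ℝ) *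
                  (1 + Real.log (k / β)) * (1 + Real.log (1 / δ)) / ε) *
                  (1 + Real.log (n * T / k ^ 2)))
                (fun i => u i (τ i))
                (LargeGame.averagePlay T (LargeGame.nrMedian A M u e T τ ω))}
              ≤ ENNReal.ofReal β) := by
  refine ⟨600, by norm_num, ?_⟩
  intro 𝒯 _ _ n k T ε δ lam β hn hk hT hε hδ hlam hβ
  have hm : 0 < Fintype.card 𝒯 := Fintype.card_pos
  refine ⟨LargeGame.exists_isNoSwapRegret hk hT,
    LargeGame.exists_isMedianMechanism 𝒯 hn hε hδ hlam.1 hβ ?_, ?_⟩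
  · calc n * Fintype.card 𝒯 = 1 * (n * 1 * Fintype.card 𝒯) := by ring
      _ ≤ T * (n * k * Fintype.card 𝒯) := by gcongr <;> omega
  · intro herr hTk A hA M hM u hu hlarge e τ
    have herr' : LargeGame.medianError n (Fintype.card 𝒯) (T * (n * k * Fintype.card 𝒯)) ε δ lam β
        ≤ 1 / 6 := by
      refine le_trans (le_of_eq ?_) herr
      unfold LargeGame.medianError
      congr 3
      push_cast
      ring
    -- The failure event lies in the event that some answer to `nrQuerier` is inaccurate.
    refine le_trans (measure_mono fun ω hω => ?_)
      (hM.2 _ (LargeGame.nrQuerier_isAdmissible A hlam.1.le hlarge e) τ)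
    by_contra hcon
    refine hω ?_
    simp only [Set.mem_ofPred_eq, not_exists, not_lt] at hcon
    exact (LargeGame.isApproxCE_nrMedian A M hu e hT hA τ ω herr' hcon).mono
      (LargeGame.approximation_bound hn hk hT hm hε hδ hlam hβ hTk)
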